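/- Let $n\ge 1$ and let $\Gamma$ be a countable discrete group of type $FP_n(\mathbb{Q})$, i.e. the trivial $\mathbb{Q}\Gamma$-module $\mathbb{Q}$ has a projective resolution $\cdots\to P_1\to P_0\to\mathbb{Q}\to 0$ with $P_0,\dots,P_n$ finitely generated. A unitary representation of $\Gamma$ is a homomorphism from $\Gamma$ to the unitary group of a separable complex Hilbert space $V$. Its group cohomology $H^k(\Gamma,V)$ is topologized as the quotient of the cocycles by the coboundaries, where cochains $\Gamma^k\to V$ carry the topology of pointwise norm convergence, and the reduced cohomology $\bar H^k(\Gamma,V)$ is the quotient of $H^k(\Gamma,V)$ by the closure of $\{0\}$. A unitary representation is irreducible if it is non-zero and has no closed invariant subspaces other than $0$ and itself; an irreducible one is non-trivial if it is not isomorphic to the trivial representation $\mathbb{C}$. The group $\Gamma$ has property $[T_n]$ if $H^k(\Gamma,V)=0$ for every unitary representation $V$ and all $1\le k\le n$; it has property $(T_n)$ if $H^k(\Gamma,V)=0$ for every unitary representation $V$ with $V^\Gamma=0$ and all $1\le k\le n$. Then: (a) $\Gamma$ has $[T_n]$ if and only if $\bar H^k(\Gamma,U)=0$ for every irreducible unitary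 representation $U$ and every $0<k\le n$. (b) $\Gamma$ has $(T_n)$ if and only if the abelianization of $\Gamma$ is finite and $\bar H^k(\Gamma,U)=0$ for every non-trivial irreducible unitary representation $U$ and every $0<k\le n$. -/

import Mathlib

open CategoryTheory

universe u

namespace HigherT

/-- A unitary representation of a discrete group `Γ` on a complex Hilbert space `V`
(continuity is automatic, as `Γ` is discrete). -/
abbrev UnitaryRep (Γ : Type u) [Group Γ] (V : Type) [NormedAddCommGroup V]
    [InnerProductSpace ℂ V] : Type u :=
  Γ →* (V ≃ₗᵢ[ℂ] V)

section Cohomology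

variable {Γ : Type u} [Group Γ] {V : Type} [NormedAddCommGroup V] [InnerProductSpace ℂ V]

/-- Inhomogeneous `k`-cochains of `Γ` with values in `V`. They carry the product topology, that
is, the topology of pointwise convergence in the norm of `V`. -/
abbrev Cochain (Γ : Type u) (V : Type) (k : ℕ) : Type u := (Fin k → Γ) → V

/-- The differential of the inhomogeneous cochain complex,
`(d f)(g₀,…,g_k) = g₀ f(g₁,…,g_k) + ∑_{j<k} (-1)^(j+1) f(…,g_j g_{j+1},…)
  + (-1)^(k+1) f(g₀,…,g_{k-1})`.
`Fin.contractNth j` multiplies the entries `j` and `j + 1`, and drops the last entry if `j = k`.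
The formula is the one of Mathlib's `inhomogeneousCochains.d`, which would force `Γ : Type`. -/
noncomputable def d (ρ : UnitaryRep Γ V) (k : ℕ) : Cochain Γ V k →ₗ[ℂ] Cochain Γ V (k + 1) where
  toFun f g :=
    ρ (g 0) (f fun i => g i.succ) +
      ∑ j : Fin (k + 1), (-1 : ℂ) ^ ((j : ℕ) + 1) • f (Fin.contractNth j (· * ·) g)
  map_add' f f' := by
    ext g
    simp [Finset.sum_add_distrib, add_add_add_comm]
  map_smul' c f := by
    ext g
    simp [Finset.smul_sum, smul_smul, mul_comm c]

/-- The cocycles `Z^k(Γ, V)`. -/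
noncomputable def cocycles (ρ : UnitaryRep Γ V) (k : ℕ) : Submodule ℂ (Cochain Γ V k) :=
  LinearMap.ker (d ρ k)

/-- The coboundaries `B^k(Γ, V)`. -/
noncomputable def coboundaries (ρ : UnitaryRep Γ V) : (k : ℕ) → Submodule ℂ (Cochain Γ V k)
  | 0 => ⊥
  | k + 1 => LinearMap.range (d ρ k)

/-- The group cohomology `H^k(Γ, V) = Z^k(Γ, V) / B^k(Γ, V)`, which carries the quotient
topology. -/
abbrev Cohomology (ρ : UnitaryRep Γ V) (k : ℕ) : Type u :=
  cocycles ρ k ⧸ (coboundaries ρ k).submoduleOf (cocycles ρ k)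

/-- The reduced cohomology: the quotient of `H^k(Γ, V)` by the closure of `{0}`, that is, its
maximal Hausdorff quotient. -/
abbrev ReducedCohomology (ρ : UnitaryRep Γ V) (k : ℕ) : Type u :=
  Cohomology ρ k ⧸ (⊥ : Submodule ℂ (Cohomology ρ k)).topologicalClosure

/-- The only `Γ`-invariant vector is zero. -/
def NoInvariantVectors (ρ : UnitaryRep Γ V) : Prop :=
  ∀ v : V, (∀ g : Γ, ρ g v = v) → v = 0

/-- Topological irreducibility: `V ≠ 0`, and `0` and `V` are the only closed invariant
subspaces. -/
def IsIrreducible (ρ : UnitaryRep Γ V) : Prop :=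
  Nontrivial V ∧ ∀ W : Submodule ℂ V, IsClosed (W : Set V) →
    (∀ g : Γ, ∀ w ∈ W, ρ g w ∈ W) → W = ⊥ ∨ W = ⊤

/-- The group acts by the identity. An irreducible representation is trivial in this sense if and
only if it is isomorphic to the one-dimensional trivial representation. -/
def IsTrivial (ρ : UnitaryRep Γ V) : Prop :=
  ∀ (g : Γ) (v : V), ρ g v = v

end Cohomology

/-- Property `[T_n]`: `H^k(Γ, V) = 0` for all `1 ≤ k ≤ n` and all unitary representations `V`
(on separable Hilbert spaces). -/
def PropertyBracketT (Γ : Type u) [Group Γ] (n : ℕ) : Prop :=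
  ∀ (V : Type) [NormedAddCommGroup V] [InnerProductSpace ℂ V] [CompleteSpace V]
    [TopologicalSpace.SeparableSpace V] (ρ : UnitaryRep Γ V),
    ∀ k : ℕ, 1 ≤ k → k ≤ n → Subsingleton (Cohomology ρ k)

/-- Property `(T_n)`: `H^k(Γ, V) = 0` for all `1 ≤ k ≤ n` and all unitary representations `V`
(on separable Hilbert spaces) without non-zero invariant vectors. -/
def PropertyParenT (Γ : Type u) [Group Γ] (n : ℕ) : Prop :=
  ∀ (V : Type) [NormedAddCommGroup V] [InnerProductSpace ℂ V] [CompleteSpace V]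
    [TopologicalSpace.SeparableSpace V] (ρ : UnitaryRep Γ V), NoInvariantVectors ρ →
    ∀ k : ℕ, 1 ≤ k → k ≤ n → Subsingleton (Cohomology ρ k)

/-- Property `FP_n(ℚ)`: the trivial `ℚΓ`-module `ℚ` has a projective resolution that is finitely
generated in degrees `0, …, n`. (`ULift` only moves `ℚ` to the universe of `Γ`.) -/
def IsFPRat (Γ : Type u) [Group Γ] (n : ℕ) : Prop :=
  ∃ P : ProjectiveResolution
      (ModuleCat.of (MonoidAlgebra ℚ Γ) (Representation.trivial ℚ Γ (ULift.{u} ℚ)).asModule),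
    ∀ i ≤ n, Module.Finite (MonoidAlgebra ℚ Γ) (P.complex.X i)

end HigherT

/-! The forward implications are formal, apart from the finiteness of the abelianization in (b). The
core of the converses is `exists_irreducible_of_cohomology`: if `H^(k+1)(Γ, V) ≠ 0` for some `V`,
then some irreducible `U` has nonzero reduced cohomology in the same degree.

By `FP_n`, the bar differential in degree `k + 1 ≤ n` is homotopy equivalent to a map `D` of free
`ℚΓ`-modules of finite rank (`exists_matrix`). Cocycles become a closed subspace `Z` of the Hilbert
space `V^m`, and coboundaries become the range of the bounded operator `V^m' → Z` dual to `D`. If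
this operator is not onto, its adjoint is not bounded below, so there are unit vectors of `Z` whose
images under the adjoint are arbitrarily small (`exists_almostHarmonic`).

Such a vector is recorded by its Gram form on the free representation `ℂΓ^m`. The normalized forms
satisfying the cocycle condition form a compact convex set, and the squared norm of the adjoint is a
continuous function (the energy) of the form. Its infimum `0` is therefore attained, and by
Krein–Milman the zero-energy forms have an extreme point (`exists_extreme_form`). The GNS
representation of that point is irreducible (`isIrreducible_of_extreme`) and contains a unit cocycle
orthogonal to all coboundaries, so its reduced cohomology is nonzero.

For (b) the irreducible representation must also be non-trivial. A spectral gap is a closed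
condition on forms that is inherited by GNS representations, so a gap for `V` gives one for `U`. The
gap comes from the vanishing of `H^1` (`exists_hasGap`), which is proved first: trivial irreducibles
have no `H^1` when the abelianization is finite. Conversely, an infinite abelianization provides a
real character, hence a diagonal representation on `ℓ²` with `H^1 ≠ 0` and no invariant vectors. -/

namespace HigherT

/-! ### The bar resolution over `ℚΓ` and its contracting homotopy. -/

section Bar

variable (Γ : Type u) [Group Γ]

/-- The `k`-th term of the inhomogeneous bar resolution over `ℚΓ`. -/
abbrev BarModule (k : ℕ) : Type u := (Fin k → Γ) →₀ MonoidAlgebra ℚ Γ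

/-- The boundary of a basis element of the bar resolution. -/
noncomputable def barBoundary (k : ℕ) (g : Fin (k + 1) → Γ) : BarModule Γ k :=
  Finsupp.single (fun i => g i.succ) (MonoidAlgebra.single (g 0) 1) +
    ∑ j : Fin (k + 1), (-1 : ℤ) ^ ((j : ℕ) + 1) •
      Finsupp.single (Fin.contractNth j (· * ·) g) (1 : MonoidAlgebra ℚ Γ)

/-- The differential of the bar resolution. -/
noncomputable def barD (k : ℕ) :
    BarModule Γ (k + 1) →ₗ[MonoidAlgebra ℚ Γ] BarModule Γ k :=
  Finsupp.linearCombination (MonoidAlgebra ℚ Γ) (barBoundary Γ k)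

/-- The contracting homotopy of the bar resolution in positive degrees. -/
noncomputable def barS (k : ℕ) : BarModule Γ k →+ BarModule Γ (k + 1) :=
  Finsupp.liftAddHom fun g =>
    (Finsupp.liftAddHom fun γ =>
      (Finsupp.singleAddHom (Fin.cons γ g : Fin (k + 1) → Γ)).comp
        (MonoidAlgebra.singleAddHom (1 : Γ))).comp
      MonoidAlgebra.coeffAddEquiv.toAddMonoidHom

/-- The augmentation of the bar resolution. -/
noncomputable def barAug : BarModule Γ 0 →ₗ[MonoidAlgebra ℚ Γ]
    (Representation.trivial ℚ Γ (ULift.{u} ℚ)).asModule :=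
  Finsupp.linearCombination (MonoidAlgebra ℚ Γ) fun _ =>
    (Representation.trivial ℚ Γ (ULift.{u} ℚ)).asModuleEquiv.symm ⟨1⟩

/-- The contracting homotopy of the bar resolution in degree `-1`. -/
noncomputable def barS₀ :
    (Representation.trivial ℚ Γ (ULift.{u} ℚ)).asModule →+ BarModule Γ 0 :=
  ((Finsupp.singleAddHom (Fin.elim0 : Fin 0 → Γ)).comp
    (MonoidAlgebra.singleAddHom (1 : Γ))).comp
    ((AddEquiv.ulift : ULift.{u} ℚ ≃+ ℚ).toAddMonoidHom.comp
      (Representation.trivial ℚ Γ (ULift.{u} ℚ)).asModuleEquiv.toLinearMap.toAddMonoidHom)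

variable {Γ}

@[simp]
lemma barS_single (k : ℕ) (g : Fin k → Γ) (γ : Γ) (q : ℚ) :
    barS Γ k (Finsupp.single g (MonoidAlgebra.single γ q)) =
      Finsupp.single (Fin.cons γ g) (MonoidAlgebra.single 1 q) := by
  simp [barS]

@[simp]
lemma barD_single (k : ℕ) (g : Fin (k + 1) → Γ) (r : MonoidAlgebra ℚ Γ) :
    barD Γ k (Finsupp.single g r) = r • barBoundary Γ k g := by
  simp [barD]

lemma contractNth_zero_cons (k : ℕ) (γ : Γ) (g : Fin (k + 1) → Γ) :
    Fin.contractNth 0 (· * ·) (Fin.cons γ g : Fin (k + 2) → Γ) =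
      Fin.cons (γ * g 0) (fun i => g i.succ) := by
  funext i
  refine Fin.cases ?_ (fun i => ?_) i
  · simp [Fin.contractNth]
  · simp [Fin.contractNth]

lemma contractNth_succ_cons (k : ℕ) (j : Fin (k + 1)) (γ : Γ) (g : Fin (k + 1) → Γ) :
    Fin.contractNth j.succ (· * ·) (Fin.cons γ g : Fin (k + 2) → Γ) =
      Fin.cons γ (Fin.contractNth j (· * ·) g) := by
  funext i
  refine Fin.cases ?_ (fun i => ?_) i
  · simp [Fin.contractNth]
  · simp [Fin.contractNth]

lemma barModule_addHom_ext {k : ℕ} {M : Type*} [AddCommMonoid M] {f f' : BarModule Γ k →+ M}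
    (h : ∀ g γ q, f (Finsupp.single g (MonoidAlgebra.single γ q)) =
      f' (Finsupp.single g (MonoidAlgebra.single γ q))) : f = f' := by
  refine Finsupp.addHom_ext fun g r => ?_
  have : (f.comp (Finsupp.singleAddHom g)) = (f'.comp (Finsupp.singleAddHom g)) :=
    MonoidAlgebra.addMonoidHom_ext fun γ q => h g γ q
  exact DFunLike.congr_fun this r

/-- Prepending `γ` to a tuple makes the leading term of the boundary return the original element;
the remaining faces cancel against the homotopy applied to the boundary. -/
lemma barD_barS (k : ℕ) (x : BarModule Γ (k + 1)) :
    barD Γ (k + 1) (barS Γ (k + 1) x) + barS Γ k (barD Γ k x) = x := by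
  have : (barD Γ (k + 1)).toAddMonoidHom.comp (barS Γ (k + 1)) +
      (barS Γ k).comp (barD Γ k).toAddMonoidHom = AddMonoidHom.id _ := by
    refine barModule_addHom_ext fun g γ q => ?_
    simp [barBoundary, Fin.sum_univ_succ (n := k + 1), contractNth_zero_cons,
      contractNth_succ_cons, smul_add, Finset.smul_sum, MonoidAlgebra.single_mul_single,
      MonoidAlgebra.one_def, map_sum, pow_succ]
    abel
  exact DFunLike.congr_fun this x

lemma barAug_single (g : Fin 0 → Γ) (γ : Γ) (q : ℚ) :
    barAug Γ (Finsupp.single g (MonoidAlgebra.single γ q)) =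
      (Representation.trivial ℚ Γ (ULift.{u} ℚ)).asModuleEquiv.symm ⟨q⟩ := by
  apply (Representation.asModuleEquiv (Representation.trivial ℚ Γ (ULift.{u} ℚ))).injective
  simp only [barAug, Finsupp.linearCombination_single,
    Representation.asModuleEquiv_map_smul, Representation.asAlgebraHom_single]
  simp only [LinearEquiv.apply_symm_apply, LinearMap.smul_apply, Representation.trivial_apply]
  ext; simp

lemma barS₀_symm (q : ℚ) :
    barS₀ Γ ((Representation.trivial ℚ Γ (ULift.{u} ℚ)).asModuleEquiv.symm ⟨q⟩) =
      Finsupp.single Fin.elim0 (MonoidAlgebra.single 1 q) := by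
  simp only [barS₀, AddMonoidHom.comp_apply]
  congr 1

lemma barD_barS_zero (x : BarModule Γ 0) :
    barD Γ 0 (barS Γ 0 x) + barS₀ Γ (barAug Γ x) = x := by
  have : (barD Γ 0).toAddMonoidHom.comp (barS Γ 0) +
      (barS₀ Γ).comp (barAug Γ).toAddMonoidHom = AddMonoidHom.id _ := by
    refine barModule_addHom_ext fun g γ q => ?_
    obtain rfl : g = Fin.elim0 := Subsingleton.elim _ _
    have h1 : (Fin.contractNth 0 (· * ·) (Fin.cons γ Fin.elim0 : Fin 1 → Γ)) = Fin.elim0 :=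
      Subsingleton.elim _ _
    simp [barAug_single, barS₀_symm, barBoundary, h1, MonoidAlgebra.one_def,
      MonoidAlgebra.single_mul_single, smul_add]
  exact DFunLike.congr_fun this x

lemma barAug_barD (x : BarModule Γ 1) : barAug Γ (barD Γ 0 x) = 0 := by
  have : (barAug Γ) ∘ₗ (barD Γ 0) = 0 := by
    refine Finsupp.lhom_ext' fun g => LinearMap.ext_ring ?_
    simp [barBoundary, barAug_single, MonoidAlgebra.one_def]
  exact DFunLike.congr_fun this x

lemma barD_barD (k : ℕ) (x : BarModule Γ (k + 2)) : barD Γ k (barD Γ (k + 1) x) = 0 := by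
  have : (barD Γ k) ∘ₗ (barD Γ (k + 1)) = 0 := by
    refine Finsupp.lhom_ext' fun g => LinearMap.ext_ring ?_
    -- Every basis element is in the image of the homotopy, so `d ∘ d = 0` follows by induction on
    -- the degree from the homotopy identity, without manipulating double sums of faces.
    have hg : Finsupp.single g (1 : MonoidAlgebra ℚ Γ) = barS Γ (k + 1)
        (Finsupp.single (Fin.tail g) (MonoidAlgebra.single (g 0) 1)) := by
      simp [MonoidAlgebra.one_def]
    simp only [LinearMap.comp_apply, Finsupp.lsingle_apply, LinearMap.zero_apply, hg]
    generalize (Finsupp.single (Fin.tail g) (MonoidAlgebra.single (g 0) (1 : ℚ))) = y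
    rw [eq_sub_of_add_eq (barD_barS k y), map_sub]
    cases k with
    | zero =>
      rw [eq_sub_of_add_eq (barD_barS_zero (barD Γ 0 y)), barAug_barD]; simp
    | succ k =>
      rw [eq_sub_of_add_eq (barD_barS k (barD Γ (k + 1) y)), barD_barD k y]; simp
  exact DFunLike.congr_fun this x

lemma barAug_surjective : Function.Surjective (barAug Γ) := fun x =>
  ⟨Finsupp.single Fin.elim0 (MonoidAlgebra.single 1
      ((Representation.trivial ℚ Γ (ULift.{u} ℚ)).asModuleEquiv x).down),
    by rw [barAug_single]; exact LinearEquiv.symm_apply_apply _ x⟩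

variable (Γ) in
/-- The bar resolution as a chain complex of `ℚΓ`-modules. -/
noncomputable abbrev barComplex : ChainComplex (ModuleCat.{u} (MonoidAlgebra ℚ Γ)) ℕ :=
  ChainComplex.of (fun k => ModuleCat.of _ (BarModule Γ k)) (fun k => ModuleCat.ofHom (barD Γ k))
    fun k => ModuleCat.hom_ext (LinearMap.ext fun x => barD_barD k x)

lemma barComplex_d (k : ℕ) : (barComplex Γ).d (k + 1) k = ModuleCat.ofHom (barD Γ k) :=
  ChainComplex.of_d (V := ModuleCat.{u} (MonoidAlgebra ℚ Γ))
    (X := fun k => ModuleCat.of _ (BarModule Γ k)) (d := fun k => ModuleCat.ofHom (barD Γ k)) k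

lemma barComplex_exact_zero :
    Function.Exact (barD Γ 0) (barAug Γ) := fun x =>
  ⟨fun h => ⟨barS Γ 0 x, by simpa [h] using barD_barS_zero x⟩,
    by rintro ⟨y, rfl⟩; exact barAug_barD y⟩

lemma barComplex_exact_succ (k : ℕ) :
    Function.Exact (barD Γ (k + 1)) (barD Γ k) := fun x =>
  ⟨fun h => ⟨barS Γ (k + 1) x, by simpa [h] using barD_barS k x⟩,
    by rintro ⟨y, rfl⟩; exact barD_barD k y⟩

variable (Γ) in
/-- The bar resolution. -/
noncomputable def barResolution : ProjectiveResolution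
    (ModuleCat.of (MonoidAlgebra ℚ Γ)
      (Representation.trivial ℚ Γ (ULift.{u} ℚ)).asModule) where
  complex := barComplex Γ
  projective n := (IsProjective.iff_projective (BarModule Γ n)).1 inferInstance
  π := (ChainComplex.toSingle₀Equiv _ _).symm ⟨ModuleCat.ofHom (barAug Γ), by
    rw [barComplex_d]
    exact ModuleCat.hom_ext (LinearMap.ext fun x => barAug_barD x)⟩
  quasiIso := ⟨fun n => by
    cases n with
    | zero =>
      rw [ChainComplex.quasiIsoAt₀_iff, ShortComplex.quasiIso_iff_of_zeros']
      · refine (ShortComplex.exact_and_epi_g_iff_of_iso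
          (S₂ := ShortComplex.mk (ModuleCat.ofHom (barD Γ 0)) (ModuleCat.ofHom (barAug Γ))
            (ModuleCat.hom_ext (LinearMap.ext fun x => barAug_barD x))) ?_).2 ⟨?_, ?_⟩
        · refine ShortComplex.isoMk (Iso.refl _) (Iso.refl _) (Iso.refl _) ?_ ?_
          · exact (Category.id_comp _).trans ((barComplex_d 0).symm.trans (Category.comp_id _).symm)
          · refine (Category.id_comp _).trans (Eq.trans ?_ (Category.comp_id _).symm)
            exact (ChainComplex.toSingle₀Equiv_symm_apply_f_zero (C := barComplex Γ)
              (X := ModuleCat.of _ (Representation.trivial ℚ Γ (ULift.{u} ℚ)).asModule)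
              (ModuleCat.ofHom (barAug Γ)) _).symm
        · exact (ShortComplex.moduleCat_exact_iff _).2 fun x hx =>
            (barComplex_exact_zero x).1 hx
        · exact (ModuleCat.epi_iff_surjective _).2 barAug_surjective
      all_goals rfl
    | succ n =>
      rw [quasiIsoAt_iff_exactAt']
      · rw [HomologicalComplex.exactAt_iff' _ (n + 1 + 1) (n + 1) n (by simp) (by simp)]
        refine (ShortComplex.moduleCat_exact_iff _).2 fun x hx => ?_
        have h1 := barComplex_d (Γ := Γ) (n + 1)
        have h2 := barComplex_d (Γ := Γ) n
        obtain ⟨y, hy⟩ := (barComplex_exact_succ n x).1 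
          ((congrArg (fun f => f.hom x) h2).symm.trans hx)
        exact ⟨y, (congrArg (fun f => f.hom y) h1).trans hy⟩
      · apply ChainComplex.exactAt_succ_single_obj⟩

end Bar

end HigherT
namespace HigherT

/-! ### Replacing the bar differential by a finite matrix. -/

section Comparison

variable {Γ : Type u} [Group Γ]

/-- After applying the differential of `E`, the half of the homotopy formula that is itself a
boundary disappears. Only one component of the homotopy survives, and no module above degree `k + 1`
is involved. -/
lemma exists_homotopy_components {C E : ChainComplex (ModuleCat.{u} (MonoidAlgebra ℚ Γ)) ℕ}
    {φ ψ : C ⟶ E} (H : Homotopy φ ψ) (k : ℕ) :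
    ∃ s : C.X k →ₗ[MonoidAlgebra ℚ Γ] E.X (k + 1), ∀ x : C.X (k + 1),
      (E.d (k + 1) k).hom ((φ.f (k + 1)).hom x) =
        (E.d (k + 1) k).hom ((ψ.f (k + 1)).hom x + s ((C.d (k + 1) k).hom x)) := by
  refine ⟨(H.hom k (k + 1)).hom, fun x => ?_⟩
  have h := H.comm (k + 1)
  rw [Homotopy.dNext_succ_chainComplex, Homotopy.prevD_chainComplex] at h
  rw [h]
  have h2 : (E.d (k + 1) k).hom ((E.d (k + 1 + 1) (k + 1)).hom
      ((H.hom (k + 1) (k + 1 + 1)).hom x)) = 0 := by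
    have := E.d_comp_d (k + 1 + 1) (k + 1) k
    exact congrArg (fun f => f.hom ((H.hom (k + 1) (k + 1 + 1)).hom x)) this
  simp only [ModuleCat.hom_add, LinearMap.add_apply, ModuleCat.hom_comp, LinearMap.comp_apply,
    map_add]
  rw [h2]
  abel

/-- A homotopy equivalence in one degree between a projective module and a map of finite modules
can be moved to a map of free modules of finite rank. -/
lemma exists_free_comparison {A : Type*} [Ring A] {B₁ B₀ P₁ P₀ : Type*} [AddCommGroup B₁]
    [Module A B₁] [AddCommGroup B₀] [Module A B₀] [AddCommGroup P₁] [Module A P₁]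
    [AddCommGroup P₀] [Module A P₀] [Module.Projective A B₁] [Module.Projective A P₀]
    [Module.Finite A P₁] [Module.Finite A P₀] {b : B₁ →ₗ[A] B₀} {d : P₁ →ₗ[A] P₀}
    {F : B₁ →ₗ[A] P₁} {H : P₁ →ₗ[A] B₁} {F₀ : B₀ →ₗ[A] P₀} {H₀ : P₀ →ₗ[A] B₀}
    {s : B₀ →ₗ[A] B₁} {t : P₀ →ₗ[A] P₁} (hF : ∀ x, d (F x) = F₀ (b x))
    (hH : ∀ y, b (H y) = H₀ (d y)) (hs : ∀ x, b (H (F x)) = b (x + s (b x)))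
    (ht : ∀ y, d (F (H y)) = d (y + t (d y))) :
    ∃ (m m' : ℕ) (D : (Fin m → A) →ₗ[A] (Fin m' → A)) (f : B₁ →ₗ[A] (Fin m → A))
      (h : (Fin m → A) →ₗ[A] B₁) (f₀ : B₀ →ₗ[A] (Fin m' → A)) (h₀ : (Fin m' → A) →ₗ[A] B₀)
      (s : B₀ →ₗ[A] B₁) (t : (Fin m' → A) →ₗ[A] (Fin m → A)),
      (∀ x, D (f x) = f₀ (b x)) ∧ (∀ y, b (h y) = h₀ (D y)) ∧
      (∀ x, b (h (f x)) = b (x + s (b x))) ∧ (∀ y, D (f (h y)) = D (y + t (D y))) := by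
  -- Free modules cover `P₁` and `P₀`; the second cover splits by a map `i`, as `P₀` is projective.
  -- The new matrix is `i ∘ d ∘ π`, and the remaining maps are lifted through `π`.
  obtain ⟨m, π, hπ⟩ := Module.Finite.exists_fin' A P₁
  obtain ⟨m', p, hp⟩ := Module.Finite.exists_fin' A P₀
  obtain ⟨i, hi⟩ := Module.projective_lifting_property p LinearMap.id hp
  obtain ⟨f, hf⟩ := Module.projective_lifting_property π F hπ
  obtain ⟨t', ht'⟩ := Module.projective_lifting_property π (t ∘ₗ p) hπ
  have hi' : ∀ z, p (i z) = z := fun z => LinearMap.congr_fun hi z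
  have hf' : ∀ z, π (f z) = F z := fun z => LinearMap.congr_fun hf z
  have ht'' : ∀ z, π (t' z) = t (p z) := fun z => LinearMap.congr_fun ht' z
  refine ⟨m, m', i ∘ₗ d ∘ₗ π, f, H ∘ₗ π, i ∘ₗ F₀, H₀ ∘ₗ p, s, t', fun x => ?_, fun y => ?_,
    fun x => ?_, fun y => ?_⟩
  · simp only [LinearMap.comp_apply, hf', hF]
  · simp only [LinearMap.comp_apply, hH, hi']
  · simp only [LinearMap.comp_apply, hf', hs]
  · simp only [LinearMap.comp_apply, hf', ht, map_add π, ht'', hi']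

/-- In a degree where a projective resolution of `ℚ` is finitely generated, it gives a finite
matrix `D` that is homotopy equivalent to the differential of the bar resolution. -/
lemma exists_matrix_comparison {n : ℕ} (hΓ : IsFPRat Γ n) (k : ℕ) (hk : k + 1 ≤ n) :
    ∃ (m m' : ℕ) (D : (Fin m → MonoidAlgebra ℚ Γ) →ₗ[MonoidAlgebra ℚ Γ]
        (Fin m' → MonoidAlgebra ℚ Γ))
      (f : BarModule Γ (k + 1) →ₗ[MonoidAlgebra ℚ Γ] (Fin m → MonoidAlgebra ℚ Γ))
      (h : (Fin m → MonoidAlgebra ℚ Γ) →ₗ[MonoidAlgebra ℚ Γ] BarModule Γ (k + 1))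
      (f₀ : BarModule Γ k →ₗ[MonoidAlgebra ℚ Γ] (Fin m' → MonoidAlgebra ℚ Γ))
      (h₀ : (Fin m' → MonoidAlgebra ℚ Γ) →ₗ[MonoidAlgebra ℚ Γ] BarModule Γ k)
      (s : BarModule Γ k →ₗ[MonoidAlgebra ℚ Γ] BarModule Γ (k + 1))
      (t : (Fin m' → MonoidAlgebra ℚ Γ) →ₗ[MonoidAlgebra ℚ Γ] (Fin m → MonoidAlgebra ℚ Γ)),
      (∀ x, D (f x) = f₀ (barD Γ k x)) ∧ (∀ y, barD Γ k (h y) = h₀ (D y)) ∧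
      (∀ x, barD Γ k (h (f x)) = barD Γ k (x + s (barD Γ k x))) ∧
      (∀ y, D (f (h y)) = D (y + t (D y))) := by
  obtain ⟨P, hP⟩ := hΓ
  let e := ProjectiveResolution.homotopyEquiv (barResolution Γ) P
  obtain ⟨s, hs⟩ := exists_homotopy_components e.homotopyHomInvId k
  obtain ⟨t, ht⟩ := exists_homotopy_components e.homotopyInvHomId k
  have hd : ((barResolution Γ).complex.d (k + 1) k).hom = barD Γ k :=
    congrArg ModuleCat.Hom.hom (barComplex_d (Γ := Γ) k)
  rw [← hd]
  have fin1 := hP (k + 1) hk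
  have fin0 := hP k (by omega)
  have proj0 : Module.Projective (MonoidAlgebra ℚ Γ) (P.complex.X k) :=
    (IsProjective.iff_projective _).2 (P.projective k)
  have proj1 : Module.Projective (MonoidAlgebra ℚ Γ) ((barResolution Γ).complex.X (k + 1)) :=
    (IsProjective.iff_projective _).2 ((barResolution Γ).projective (k + 1))
  have key := exists_free_comparison (B₁ := (barResolution Γ).complex.X (k + 1))
    (B₀ := (barResolution Γ).complex.X k)
    (fun x => congrArg (fun f => f.hom x) (e.hom.comm (k + 1) k))
    (fun x => congrArg (fun f => f.hom x) (e.inv.comm (k + 1) k)) hs ht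
  exact key

end Comparison

/-! ### The action of `ℚΓ` on complex representations. -/

section Action

variable {Γ : Type u} [Group Γ] {W : Type*} [AddCommGroup W] [Module ℂ W]

/-- The action of `ℚΓ` on a complex representation. -/
noncomputable def ratAct (σ : Γ →* Module.End ℂ W) : MonoidAlgebra ℚ Γ →+* Module.End ℂ W :=
  MonoidAlgebra.liftNCRingHom ((algebraMap ℂ (Module.End ℂ W)).comp (algebraMap ℚ ℂ)) σ
    fun q g => Algebra.commutes (A := Module.End ℂ W) (q : ℂ) (σ g)

@[simp]
lemma ratAct_single (σ : Γ →* Module.End ℂ W) (g : Γ) (q : ℚ) (w : W) :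
    ratAct σ (MonoidAlgebra.single g q) w = (q : ℂ) • σ g w := by
  have := MonoidAlgebra.liftNCRingHom_single ((algebraMap ℂ (Module.End ℂ W)).comp
    (algebraMap ℚ ℂ)) σ (fun q g => Algebra.commutes (A := Module.End ℂ W) (q : ℂ) (σ g)) g q
  rw [ratAct, this]
  simp [Module.algebraMap_end_apply]

/-- An equivariant map commutes with the action of `ℚΓ`. -/
lemma map_ratAct {W' : Type*} [AddCommGroup W'] [Module ℂ W'] (σ : Γ →* Module.End ℂ W)
    (σ' : Γ →* Module.End ℂ W') (L : W →ₗ[ℂ] W') (hL : ∀ g w, L (σ g w) = σ' g (L w))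
    (a : MonoidAlgebra ℚ Γ) (w : W) : L (ratAct σ a w) = ratAct σ' a (L w) := by
  induction a using MonoidAlgebra.induction_linear with
  | zero => simp
  | add x y hx hy => simp [hx, hy]
  | single g q => simp [hL]

variable {V : Type} [NormedAddCommGroup V] [InnerProductSpace ℂ V]

/-- The linear representation underlying a unitary representation. -/
def UnitaryRep.toEnd (ρ : UnitaryRep Γ V) : Γ →* Module.End ℂ V where
  toFun g := (ρ g).toLinearEquiv.toLinearMap
  map_one' := by ext; simp
  map_mul' g h := by ext; simp

@[simp]
lemma UnitaryRep.toEnd_apply (ρ : UnitaryRep Γ V) (g : Γ) (v : V) : ρ.toEnd g v = ρ g v := rfl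

lemma continuous_ratAct (ρ : UnitaryRep Γ V) (a : MonoidAlgebra ℚ Γ) :
    Continuous (ratAct ρ.toEnd a) := by
  induction a using MonoidAlgebra.induction_linear with
  | zero => rw [map_zero]; exact continuous_zero
  | add x y hx hy => rw [map_add]; exact hx.add hy
  | single g q =>
    have : Continuous fun v => (q : ℂ) • ρ g v := (ρ g).continuous.const_smul _
    exact this.congr fun v => by simp

end Action

/-! ### Cohomology in terms of the matrix `D`. -/

section Matrix

variable {Γ : Type u} [Group Γ] {V : Type} [NormedAddCommGroup V] [InnerProductSpace ℂ V]

local notation "ℚΓ" => MonoidAlgebra ℚ Γ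

/-- A cochain is a `ℚΓ`-linear map on the bar module, given on its basis; under this identification
the cochain differential is precomposition with the bar differential. -/
lemma linearCombination_d (ρ : UnitaryRep Γ V) [Module ℚΓ V]
    (hV : ∀ (a : ℚΓ) (v : V), a • v = ratAct ρ.toEnd a v) (k : ℕ) (c : Cochain Γ V k)
    (x : BarModule Γ (k + 1)) :
    Finsupp.linearCombination ℚΓ (d ρ k c) x = Finsupp.linearCombination ℚΓ c (barD Γ k x) := by
  have : Finsupp.linearCombination ℚΓ (d ρ k c) = Finsupp.linearCombination ℚΓ c ∘ₗ barD Γ k := by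
    refine Finsupp.lhom_ext' fun g => LinearMap.ext_ring ?_
    simp only [LinearMap.comp_apply, Finsupp.lsingle_apply, Finsupp.linearCombination_single,
      one_smul, barD_single, barBoundary, map_add, map_sum, map_zsmul, hV, ratAct_single,
      UnitaryRep.toEnd_apply]
    simp only [d, LinearMap.coe_mk, AddHom.coe_mk, Rat.cast_one, one_smul]
    simp only [map_one, Module.End.one_apply]
    refine congrArg (fun z : V => _ + z) (Finset.sum_congr rfl fun j _ => ?_)
    rw [← Int.cast_smul_eq_zsmul ℂ, Int.cast_pow, Int.cast_neg, Int.cast_one]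
  exact LinearMap.congr_fun this x

lemma linearCombination_eq_of_mem_cocycles (ρ : UnitaryRep Γ V) [Module ℚΓ V]
    (hV : ∀ (a : ℚΓ) (v : V), a • v = ratAct ρ.toEnd a v) (k : ℕ) {c : Cochain Γ V (k + 1)}
    (hc : c ∈ cocycles ρ (k + 1)) {x y : BarModule Γ (k + 1)} (hxy : barD Γ k x = barD Γ k y) :
    Finsupp.linearCombination ℚΓ c x = Finsupp.linearCombination ℚΓ c y := by
  obtain ⟨z, hz⟩ := (barComplex_exact_succ k (x - y)).1 (by rw [map_sub, hxy, sub_self])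
  rw [← sub_eq_zero, ← map_sub, ← hz, ← linearCombination_d ρ hV, LinearMap.mem_ker.1 hc]
  simp

lemma comp_eq_linearCombination {M : Type*} [AddCommGroup M] [Module ℚΓ M] {m : ℕ}
    (φ : (Fin m → ℚΓ) →ₗ[ℚΓ] M) (y : Fin m → ℚΓ) :
    φ y = ∑ j, y j • φ (Pi.single j 1) := by
  conv_lhs => rw [pi_eq_sum_univ' y]
  rw [map_sum]
  refine Finset.sum_congr rfl fun j _ => ?_
  rw [map_smul]

/-- The `V`-cochains killing the kernel of `D`. -/
def matrixCocycles (ρ : UnitaryRep Γ V) {m m' : ℕ} (D : (Fin m → ℚΓ) →ₗ[ℚΓ] (Fin m' → ℚΓ)) :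
    Set (Fin m → V) :=
  {x | ∀ y, D y = 0 → ∑ j, ratAct ρ.toEnd (y j) (x j) = 0}

/-- The dual of `D` with values in `V`. -/
noncomputable def matrixDual (ρ : UnitaryRep Γ V) {m m' : ℕ}
    (D : (Fin m → ℚΓ) →ₗ[ℚΓ] (Fin m' → ℚΓ)) (w : Fin m' → V) : Fin m → V :=
  fun j => ∑ i, ratAct ρ.toEnd (D (Pi.single j 1) i) (w i)

/-- One `D` serves all representations at once, so it can pass from `V` to the irreducible `U`. The
cocycle condition ranges over the whole kernel of `D`, which need not be finitely generated; this is
why the top degree `n` is included. Only the two implications used later are stated: one for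
unreduced cohomology of `V`, one for reduced cohomology of `U`. -/
lemma exists_matrix {n : ℕ} (hΓ : IsFPRat Γ n) (k : ℕ) (hk : k + 1 ≤ n) :
    ∃ (m m' : ℕ) (D : (Fin m → ℚΓ) →ₗ[ℚΓ] (Fin m' → ℚΓ)),
      ∀ (V : Type) [NormedAddCommGroup V] [InnerProductSpace ℂ V] (ρ : UnitaryRep Γ V),
        (matrixCocycles ρ D ⊆ Set.range (matrixDual ρ D) → cocycles ρ (k + 1) ≤ coboundaries ρ (k + 1)) ∧
        (((cocycles ρ (k + 1) : Set (Cochain Γ V (k + 1))) ⊆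
          closure (coboundaries ρ (k + 1) : Set (Cochain Γ V (k + 1)))) →
          matrixCocycles ρ D ⊆ closure (Set.range (matrixDual ρ D))) := by
  obtain ⟨m, m', D, f, h, f₀, h₀, s, t, H1, H2, H3, H4⟩ := exists_matrix_comparison hΓ k hk
  refine ⟨m, m', D, fun V _ _ ρ => ?_⟩
  let : Module ℚΓ V := Module.compHom V (ratAct ρ.toEnd)
  have hV : ∀ (a : ℚΓ) (v : V), a • v = ratAct ρ.toEnd a v := fun _ _ => rfl
  have hdual : ∀ (w : Fin m' → V) (j : Fin m), matrixDual ρ D w j =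
      Fintype.linearCombination ℚΓ w (D (Pi.single j 1)) := fun w j => by
    simp [matrixDual, Fintype.linearCombination_apply, hV]
  constructor
  · intro hZ c hc
    obtain ⟨u, hu⟩ := hZ (a := fun j => Finsupp.linearCombination ℚΓ c (h (Pi.single j 1))) (by
      intro y hy
      have := comp_eq_linearCombination (Finsupp.linearCombination ℚΓ c ∘ₗ h) y
      simp only [LinearMap.comp_apply, hV] at this
      rw [← this, linearCombination_eq_of_mem_cocycles ρ hV k hc (y := 0), map_zero]
      rw [H2, hy, map_zero, map_zero])
    have hu' : Finsupp.linearCombination ℚΓ c ∘ₗ h = Fintype.linearCombination ℚΓ u ∘ₗ D := by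
      refine LinearMap.pi_ext' fun j => LinearMap.ext_ring ?_
      exact (congrFun hu j).symm.trans (hdual u j)
    -- The cocycle satisfies `c (h (f x)) = c x + c (s (b x))`, with `b` the bar differential, and
    -- `c ∘ h = u ∘ D`. Hence `c x = u (f₀ (b x)) - c (s (b x))`, which dictates this primitive.
    let W : BarModule Γ k →ₗ[ℚΓ] V :=
      Fintype.linearCombination ℚΓ u ∘ₗ f₀ - Finsupp.linearCombination ℚΓ c ∘ₗ s
    let w : Cochain Γ V k := fun g => W (Finsupp.single g 1)
    have hw : Finsupp.linearCombination ℚΓ w = W :=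
      Finsupp.lhom_ext' fun g => LinearMap.ext_ring (by simp [w])
    refine ⟨w, ?_⟩
    ext g
    have e1 := linearCombination_d ρ hV k w (Finsupp.single g 1)
    rw [Finsupp.linearCombination_single, one_smul, hw] at e1
    rw [e1]
    simp only [W, LinearMap.sub_apply, LinearMap.comp_apply, ← H1]
    rw [← LinearMap.comp_apply, ← hu', LinearMap.comp_apply,
      linearCombination_eq_of_mem_cocycles ρ hV k hc (H3 _), map_add]
    simp
  · intro hZ x hx
    have hx' : ∀ y y', D y = D y' →
        Fintype.linearCombination ℚΓ x y = Fintype.linearCombination ℚΓ x y' := by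
      intro y y' hyy
      rw [← sub_eq_zero, ← map_sub]
      simpa [Fintype.linearCombination_apply, hV] using hx (y - y') (by simp [hyy])
    let c : Cochain Γ V (k + 1) := fun g => Fintype.linearCombination ℚΓ x (f (Finsupp.single g 1))
    have hcl : Finsupp.linearCombination ℚΓ c = Fintype.linearCombination ℚΓ x ∘ₗ f :=
      Finsupp.lhom_ext' fun g => LinearMap.ext_ring (by simp [c])
    have hc : c ∈ cocycles ρ (k + 1) := by
      refine LinearMap.mem_ker.2 ?_
      ext g
      have e1 := linearCombination_d ρ hV (k + 1) c (Finsupp.single g 1)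
      rw [Finsupp.linearCombination_single, one_smul, hcl] at e1
      rw [e1, LinearMap.comp_apply, hx' _ 0, map_zero]; rfl
      rw [H1, barD_barD, map_zero, map_zero]
    -- Pulling back along `h` recovers `x` from `x ∘ f` only up to the homotopy term `x ∘ t ∘ D`.
    -- Subtracting that term, with `x` fixed, gives a continuous affine map that sends `c` exactly
    -- to `x` and coboundaries into the range of the dual of `D`.
    let Φ : Cochain Γ V (k + 1) → Fin m → V := fun c j =>
      Finsupp.linearCombination ℚΓ c (h (Pi.single j 1)) -
        Fintype.linearCombination ℚΓ x (t (D (Pi.single j 1)))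
    have hΦ : Continuous Φ := by
      refine continuous_pi fun j => Continuous.sub ?_ continuous_const
      simp only [Finsupp.linearCombination_apply, Finsupp.sum]
      refine continuous_finsetSum _ fun g _ => ?_
      exact (continuous_ratAct ρ _).comp (continuous_apply g)
    have hΦc : Φ c = x := by
      ext j
      simp only [Φ, hcl, LinearMap.comp_apply]
      rw [hx' _ _ (H4 _), map_add]
      simp
    have hΦB : Set.MapsTo Φ (coboundaries ρ (k + 1)) (Set.range (matrixDual ρ D)) := by
      rintro _ ⟨w, rfl⟩
      refine ⟨fun i => Finsupp.linearCombination ℚΓ w (h₀ (Pi.single i 1)) -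
        Fintype.linearCombination ℚΓ x (t (Pi.single i 1)), ?_⟩
      ext j
      simp only [Φ, linearCombination_d ρ hV, H2]
      have := comp_eq_linearCombination (Finsupp.linearCombination ℚΓ w ∘ₗ h₀ -
        Fintype.linearCombination ℚΓ x ∘ₗ t) (D (Pi.single j 1))
      simp only [LinearMap.comp_apply, LinearMap.sub_apply, hV] at this
      rw [this]
      rfl
    rw [← hΦc]
    exact map_mem_closure hΦ (hZ hc) hΦB

end Matrix

/-! ### Vanishing of cohomology and of reduced cohomology. -/

section Topology

variable {Γ : Type u} [Group Γ] {V : Type} [NormedAddCommGroup V] [InnerProductSpace ℂ V]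

lemma subsingleton_cohomology_iff (ρ : UnitaryRep Γ V) (k : ℕ) :
    Subsingleton (Cohomology ρ k) ↔ cocycles ρ k ≤ coboundaries ρ k := by
  rw [Submodule.Quotient.subsingleton_iff, Submodule.submoduleOf_eq_top]

/-- The quotient map by the coboundaries is open, so the preimage of the closure of `0` is the
closure of the coboundaries. -/
lemma cocycles_subset_closure_coboundaries (ρ : UnitaryRep Γ V) (k : ℕ)
    (H : Subsingleton (ReducedCohomology ρ k)) :
    (cocycles ρ k : Set (Cochain Γ V k)) ⊆ closure (coboundaries ρ k : Set (Cochain Γ V k)) := by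
  rw [Submodule.Quotient.subsingleton_iff] at H
  have key : ∀ c : cocycles ρ k, c ∈ closure
        (((coboundaries ρ k).submoduleOf (cocycles ρ k) : Set (cocycles ρ k))) := by
    have h := (Submodule.isOpenMap_mkQ ((coboundaries ρ k).submoduleOf (cocycles ρ k))
      ).preimage_closure_eq_closure_preimage
      (Submodule.isQuotientMap_mkQ _).continuous (⊥ : Submodule ℂ (Cohomology ρ k))
    have h' : (Submodule.mkQ ((coboundaries ρ k).submoduleOf (cocycles ρ k))) ⁻¹'
        ((⊥ : Submodule ℂ (Cohomology ρ k)) : Set (Cohomology ρ k)) =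
        ((coboundaries ρ k).submoduleOf (cocycles ρ k) : Set (cocycles ρ k)) := by
      ext c
      simp [Submodule.Quotient.mk_eq_zero]
    rw [h'] at h
    rw [← h]
    exact fun c => Submodule.eq_top_iff'.1 H _
  intro c hc
  exact map_mem_closure continuous_subtype_val (key ⟨c, hc⟩) fun x hx => hx

end Topology

end HigherT
namespace HigherT

/-! ### The adjoint of `D` and almost harmonic cocycles. -/

section Adjoint

variable {Γ : Type u} [Group Γ]

local notation "ℚΓ" => MonoidAlgebra ℚ Γ

/-- The involution of `ℚΓ` that inverts the group elements. -/
noncomputable def ratStar : ℚΓ →+ ℚΓ :=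
  MonoidAlgebra.liftNC (MonoidAlgebra.singleAddHom (1 : Γ)) fun g => MonoidAlgebra.single g⁻¹ 1

@[simp]
lemma ratStar_single (g : Γ) (q : ℚ) :
    ratStar (MonoidAlgebra.single g q) = MonoidAlgebra.single g⁻¹ q := by
  rw [ratStar, MonoidAlgebra.liftNC_single]
  simp [MonoidAlgebra.single_mul_single]

/-- The elements of `(ℚΓ)^m` that give the coordinates of the adjoint of `D`. -/
noncomputable def adjointCoeff {m m' : ℕ} (D : (Fin m → ℚΓ) →ₗ[ℚΓ] (Fin m' → ℚΓ)) (i : Fin m') :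
    Fin m → ℚΓ :=
  fun j => ratStar (D (Pi.single j 1) i)

variable {V : Type} [NormedAddCommGroup V] [InnerProductSpace ℂ V] (ρ : UnitaryRep Γ V)

lemma UnitaryRep.inner_apply_left (g : Γ) (v w : V) :
    inner ℂ (ρ g v) w = inner ℂ v (ρ g⁻¹ w) := by
  rw [← (ρ g⁻¹).inner_map_map]
  congr 1
  change (ρ g⁻¹ * ρ g) v = v
  rw [← map_mul]
  simp

lemma inner_ratAct_left (a : ℚΓ) (v w : V) :
    inner ℂ (ratAct ρ.toEnd a v) w = inner ℂ v (ratAct ρ.toEnd (ratStar a) w) := by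
  induction a using MonoidAlgebra.induction_linear with
  | zero => simp
  | add x y hx hy =>
    simp only [map_add, LinearMap.add_apply, inner_add_left, inner_add_right, hx, hy]
  | single g q =>
    rw [ratStar_single, ratAct_single, ratAct_single, inner_smul_left, inner_smul_right,
      ρ.toEnd_apply, ρ.toEnd_apply, ρ.inner_apply_left]
    simp

/-- The evaluation of a family of elements of `ℚΓ` on a family of vectors. -/
noncomputable def ratEval {W : Type*} [AddCommGroup W] [Module ℂ W] (σ : Γ →* Module.End ℂ W)
    {m : ℕ} (y : Fin m → ℚΓ) (x : Fin m → W) : W :=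
  ∑ j, ratAct σ (y j) (x j)

lemma map_ratEval {m : ℕ} {W W' : Type*} [AddCommGroup W] [Module ℂ W] [AddCommGroup W'] [Module ℂ W']
    (σ : Γ →* Module.End ℂ W) (σ' : Γ →* Module.End ℂ W') (L : W →ₗ[ℂ] W')
    (hL : ∀ g w, L (σ g w) = σ' g (L w)) (y : Fin m → ℚΓ) (x : Fin m → W) :
    L (ratEval σ y x) = ratEval σ' y fun j => L (x j) := by
  simp [ratEval, map_ratAct σ σ' L hL]

lemma sum_inner_matrixDual {m m' : ℕ} (D : (Fin m → ℚΓ) →ₗ[ℚΓ] (Fin m' → ℚΓ)) (w : Fin m' → V)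
    (x : Fin m → V) :
    ∑ j, inner ℂ (matrixDual ρ D w j) (x j) =
      ∑ i, inner ℂ (w i) (ratEval ρ.toEnd (adjointCoeff D i) x) := by
  simp only [matrixDual, sum_inner, inner_ratAct_left, ratEval, inner_sum, adjointCoeff]
  exact Finset.sum_comm

/-- The action of an element of `ℚΓ` as a bounded operator. -/
noncomputable def ratActL (a : ℚΓ) : V →L[ℂ] V := ⟨ratAct ρ.toEnd a, continuous_ratAct ρ a⟩

/-- The dual of `D` as a bounded operator between Hilbert spaces. -/
noncomputable def matrixDualL {m m' : ℕ} (D : (Fin m → ℚΓ) →ₗ[ℚΓ] (Fin m' → ℚΓ)) :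
    PiLp 2 (fun _ : Fin m' => V) →L[ℂ] PiLp 2 (fun _ : Fin m => V) :=
  (PiLp.continuousLinearEquiv 2 ℂ (fun _ : Fin m => V)).symm.toContinuousLinearMap ∘L
    (ContinuousLinearMap.pi fun j => ∑ i, (ratActL ρ (D (Pi.single j 1) i)) ∘L
      ContinuousLinearMap.proj i) ∘L
    (PiLp.continuousLinearEquiv 2 ℂ (fun _ : Fin m' => V)).toContinuousLinearMap

lemma matrixDualL_apply {m m' : ℕ} (D : (Fin m → ℚΓ) →ₗ[ℚΓ] (Fin m' → ℚΓ))
    (w : PiLp 2 (fun _ : Fin m' => V)) (j : Fin m) :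
    matrixDualL ρ D w j = matrixDual ρ D w j := by
  simp [matrixDualL, matrixDual, ratActL]

lemma matrixDual_mem_matrixCocycles {m m' : ℕ} (D : (Fin m → ℚΓ) →ₗ[ℚΓ] (Fin m' → ℚΓ))
    (w : Fin m' → V) : matrixDual ρ D w ∈ matrixCocycles ρ D := by
  intro y hy
  have h : ∀ i, ∑ j, y j * D (Pi.single j 1) i = 0 := fun i => by
    have := congrFun (comp_eq_linearCombination D y) i
    simpa [hy] using this.symm
  simp only [matrixDual, map_sum]
  rw [Finset.sum_comm]
  refine Finset.sum_eq_zero fun i _ => ?_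
  have := congrArg (fun a => ratAct ρ.toEnd a (w i)) (h i)
  simpa using this

/-- `matrixCocycles` as a subspace of the Hilbert space `V^m`. -/
noncomputable def matrixCocyclesL {m m' : ℕ} (D : (Fin m → ℚΓ) →ₗ[ℚΓ] (Fin m' → ℚΓ)) :
    Submodule ℂ (PiLp 2 (fun _ : Fin m => V)) where
  carrier := {x | (x : Fin m → V) ∈ matrixCocycles ρ D}
  zero_mem' := by intro y _; simp
  add_mem' {a b} ha hb := by
    intro y hy
    have h1 := ha y hy
    have h2 := hb y hy
    simp [Finset.sum_add_distrib, h1, h2]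
  smul_mem' c a ha := by
    intro y hy
    have h1 := ha y hy
    simp [← Finset.smul_sum, h1]

lemma isClosed_matrixCocyclesL {m m' : ℕ} (D : (Fin m → ℚΓ) →ₗ[ℚΓ] (Fin m' → ℚΓ)) :
    IsClosed (matrixCocyclesL ρ D : Set (PiLp 2 (fun _ : Fin m => V))) := by
  have : (matrixCocyclesL ρ D : Set (PiLp 2 (fun _ : Fin m => V))) =
      ⋂ y, ⋂ (_ : D y = 0), {x | ∑ j, ratAct ρ.toEnd (y j) (x j) = 0} := by
    ext x
    simp [matrixCocyclesL, matrixCocycles]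
  rw [this]
  refine isClosed_iInter fun y => isClosed_iInter fun _ => isClosed_eq ?_ continuous_const
  exact continuous_finsetSum _ fun j _ =>
    (continuous_ratAct ρ _).comp (PiLp.continuous_apply 2 _ j)

/-- If the dual of `D` does not map onto the cocycles, there are unit cocycles that are almost
orthogonal to its range. -/
lemma exists_almostHarmonic [CompleteSpace V] {m m' : ℕ} (D : (Fin m → ℚΓ) →ₗ[ℚΓ] (Fin m' → ℚΓ))
    (hD : ¬ matrixCocycles ρ D ⊆ Set.range (matrixDual ρ D)) {ε : ℝ} (hε : 0 < ε) :
    ∃ x ∈ matrixCocycles ρ D, ∑ j, ‖x j‖ ^ 2 = 1 ∧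
      ∑ i, ‖ratEval ρ.toEnd (adjointCoeff D i) x‖ ^ 2 ≤ ε := by
  by_contra! hcon
  apply hD
  let Z := matrixCocyclesL ρ D
  have : CompleteSpace Z := (isClosed_matrixCocyclesL ρ D).completeSpace_coe
  -- The target is restricted to the cocycles: a lower bound for the adjoint on `Z` alone makes `T
  -- T*` invertible, and so `T` surjective onto `Z`.
  let T : PiLp 2 (fun _ : Fin m' => V) →L[ℂ] Z := (matrixDualL ρ D).codRestrict Z fun w => by
    have h := matrixDual_mem_matrixCocycles ρ D w
    have : ((matrixDualL ρ D w : PiLp 2 (fun _ : Fin m => V)) : Fin m → V) = matrixDual ρ D w :=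
      funext fun j => matrixDualL_apply ρ D w j
    change _ ∈ matrixCocycles ρ D
    rwa [this]
  have hT : ∀ z : Z, ‖T.adjoint z‖ ^ 2 =
      ∑ i, ‖ratEval ρ.toEnd (adjointCoeff D i) (z : PiLp 2 (fun _ : Fin m => V))‖ ^ 2 := by
    intro z
    have : T.adjoint z = WithLp.toLp 2 fun i =>
        ratEval ρ.toEnd (adjointCoeff D i) (z : PiLp 2 (fun _ : Fin m => V)) := by
      refine ext_inner_left ℂ fun w => ?_
      rw [ContinuousLinearMap.adjoint_inner_right, PiLp.inner_apply, ← sum_inner_matrixDual ρ D,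
        Submodule.coe_inner, PiLp.inner_apply]
      exact Finset.sum_congr rfl fun j _ => by rw [← matrixDualL_apply]; rfl
    rw [this, PiLp.norm_sq_eq_of_L2]
  have hbound : ∀ z : Z, ε * ‖z‖ ^ 2 ≤ ‖T.adjoint z‖ ^ 2 := by
    intro z
    rcases eq_or_ne z 0 with rfl | hz
    · simp
    have hz' : ‖z‖ ≠ 0 := norm_ne_zero_iff.2 hz
    let z' : Z := ((‖z‖⁻¹ : ℝ) : ℂ) • z
    have hz1 : ‖z'‖ = 1 := by
      rw [norm_smul, Complex.norm_real, norm_inv, norm_norm, inv_mul_cancel₀ hz']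
    have h1 := hcon ((z' : PiLp 2 (fun _ : Fin m => V)) : Fin m → V) z'.2 (by
      rw [← PiLp.norm_sq_eq_of_L2, ← Submodule.coe_norm, hz1, one_pow])
    rw [← hT, map_smul, norm_smul] at h1
    simp only [Complex.norm_real, norm_inv, norm_norm, mul_pow, inv_pow] at h1
    have := mul_le_mul_of_nonneg_right h1.le (sq_nonneg ‖z‖)
    rwa [mul_comm (_⁻¹), mul_assoc, inv_mul_cancel₀ (pow_ne_zero 2 hz'), mul_one] at this
  have hunit : IsUnit (T ∘L T.adjoint) := by
    refine ContinuousLinearMap.isUnit_of_forall_le_norm_inner_map _ (c := ⟨ε, hε.le⟩) hε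
      fun z => ?_
    rw [ContinuousLinearMap.comp_apply, ← ContinuousLinearMap.adjoint_inner_right,
      inner_self_eq_norm_sq_to_K]
    refine (mul_comm _ _).le.trans ((hbound z).trans_eq ?_)
    simp
  intro x hx
  obtain ⟨z, hz⟩ := (ContinuousLinearMap.isUnit_iff_bijective.1 hunit).2 ⟨WithLp.toLp 2 x, hx⟩
  refine ⟨T.adjoint z, funext fun j => ?_⟩
  rw [← matrixDualL_apply]
  exact congrArg (fun z : Z => (z : PiLp 2 (fun _ : Fin m => V)) j) hz

end Adjoint

end HigherT
namespace HigherT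

/-! ### The GNS construction for invariant forms. -/

section GNS

open UniformSpace

variable {Γ : Type u} [Group Γ]

lemma isometry_end {E : Type*} [SeminormedAddCommGroup E] [InnerProductSpace ℂ E]
    {σ : Γ →* Module.End ℂ E} (hσ : ∀ g x, ‖σ g x‖ = ‖x‖) (g : Γ) : Isometry (σ g) :=
  AddMonoidHomClass.isometry_of_norm (σ g) (hσ g)

/-- The extension of an isometric action to the completion. -/
noncomputable def completionRep {E : Type} [SeminormedAddCommGroup E] [InnerProductSpace ℂ E]
    (σ : Γ →* Module.End ℂ E) (hσ : ∀ g x, ‖σ g x‖ = ‖x‖) : UnitaryRep Γ (Completion E) :=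
  have hu : ∀ g, UniformContinuous (σ g) := fun g => (isometry_end hσ g).uniformContinuous
  have hmul : ∀ (g h : Γ) (x : Completion E), Completion.map (σ g) (Completion.map (σ h) x) =
      Completion.map (σ (g * h)) x := fun g h x => by
    refine Completion.induction_on x ?_ fun a => ?_
    · exact isClosed_eq (Completion.continuous_map.comp Completion.continuous_map)
        Completion.continuous_map
    · rw [Completion.map_coe (hu _), Completion.map_coe (hu _), Completion.map_coe (hu _), map_mul]
      rfl
  have hone : ∀ x : Completion E, Completion.map (σ 1) x = x := fun x => by
    refine Completion.induction_on x ?_ fun a => ?_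
    · exact isClosed_eq Completion.continuous_map continuous_id
    · rw [Completion.map_coe (hu _), map_one]
      rfl
  { toFun g :=
      { toFun := Completion.map (σ g)
        invFun := Completion.map (σ g⁻¹)
        left_inv x := by rw [hmul, inv_mul_cancel, hone]
        right_inv x := by rw [hmul, mul_inv_cancel, hone]
        map_add' x y := by
          refine Completion.induction_on₂ x y ?_ fun a b => ?_
          · exact isClosed_eq (Completion.continuous_map.comp continuous_add)
              (Continuous.add (f := fun p : Completion E × Completion E => Completion.map (σ g) p.1)
                (g := fun p : Completion E × Completion E => Completion.map (σ g) p.2)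
                (Completion.continuous_map.comp continuous_fst)
                (Completion.continuous_map.comp continuous_snd))
          ·
            rw [← Completion.coe_add, Completion.map_coe (hu _), Completion.map_coe (hu _),
              Completion.map_coe (hu _), map_add, Completion.coe_add]
        map_smul' r x := by
          refine Completion.induction_on x ?_ fun a => ?_
          · exact isClosed_eq (Completion.continuous_map.comp (continuous_const_smul r))
              (Continuous.const_smul (g := fun x => Completion.map (σ g) x)
                Completion.continuous_map r)
          ·
            rw [← Completion.coe_smul, Completion.map_coe (hu _), Completion.map_coe (hu _),
              map_smul, Completion.coe_smul, RingHom.id_apply]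
        norm_map' x := by
          change ‖Completion.map (σ g) x‖ = ‖x‖
          refine Completion.induction_on x ?_ fun a => ?_
          · exact isClosed_eq Completion.continuous_map.norm continuous_norm
          · rw [Completion.map_coe (hu _), Completion.norm_coe, Completion.norm_coe, hσ] }
    map_one' := LinearIsometryEquiv.ext hone
    map_mul' g h := LinearIsometryEquiv.ext fun x => (hmul g h x).symm }

lemma completionRep_coe {E : Type} [SeminormedAddCommGroup E] [InnerProductSpace ℂ E]
    (σ : Γ →* Module.End ℂ E) (hσ : ∀ g x, ‖σ g x‖ = ‖x‖) (g : Γ) (x : E) :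
    completionRep σ hσ g (x : Completion E) = ((σ g x : E) : Completion E) :=
  Completion.map_coe (isometry_end hσ g).uniformContinuous x

/-- The Gelfand–Naimark–Segal construction: an invariant positive semidefinite form on a linear
representation comes from an equivariant map with dense range to a unitary representation. -/
lemma exists_gns {E : Type} [AddCommGroup E] [Module ℂ E] (σ : Γ →* Module.End ℂ E)
    (c : PreInnerProductSpace.Core ℂ E)
    (hinv : ∀ g a b, c.inner (σ g a) (σ g b) = c.inner a b) :
    ∃ (U : Type) (_ : NormedAddCommGroup U) (_ : InnerProductSpace ℂ U) (_ : CompleteSpace U)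
      (ρ : UnitaryRep Γ U) (j : E →ₗ[ℂ] U), DenseRange j ∧ (∀ g a, j (σ g a) = ρ g (j a)) ∧
      ∀ a b, inner ℂ (j a) (j b) = c.inner a b := by
  let : SeminormedAddCommGroup E := InnerProductSpace.Core.toSeminormedAddCommGroup (c := c)
  let : InnerProductSpace ℂ E := InnerProductSpace.ofCore c
  have hσ : ∀ g x, ‖σ g x‖ = ‖x‖ := fun g x => by
    rw [@norm_eq_sqrt_re_inner ℂ, @norm_eq_sqrt_re_inner ℂ]
    exact congrArg (fun z : ℂ => √(RCLike.re z)) (hinv g x x)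
  refine ⟨Completion E, inferInstance, inferInstance, inferInstance, completionRep σ hσ,
    (Completion.toComplₗᵢ : E →ₗᵢ[ℂ] Completion E).toLinearMap, Completion.denseRange_coe,
    fun g a => (completionRep_coe σ hσ g a).symm, fun a b => Completion.inner_coe a b⟩

end GNS

/-! ### The free representation, placed in `Type` by countability of `Γ`. -/

section FreeRep

variable (Γ : Type u) [Group Γ] [Countable Γ] (m : ℕ)

/-- The free complex representation of `Γ` of rank `m`. -/
abbrev FreeRep : Type := (Fin m × Shrink.{0} Γ) →₀ ℂ

namespace FreeRep

/-- The action of `Γ` on the free representation. -/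
noncomputable def action : Γ →* Module.End ℂ (FreeRep Γ m) where
  toFun g := Finsupp.lmapDomain ℂ ℂ fun p => (p.1, equivShrink.{0} Γ (g * (equivShrink.{0} Γ).symm p.2))
  map_one' := by
    refine Finsupp.lhom_ext' fun p => LinearMap.ext_ring ?_
    simp
  map_mul' g h := by
    refine Finsupp.lhom_ext' fun p => LinearMap.ext_ring ?_
    simp [mul_assoc]

/-- The basis of the free representation. -/
noncomputable def gen (j : Fin m) : FreeRep Γ m := Finsupp.single (j, equivShrink.{0} Γ 1) 1

variable {Γ m}

lemma single_eq (p : Fin m × Shrink.{0} Γ) :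
    (Finsupp.single p 1 : FreeRep Γ m) = action Γ m ((equivShrink.{0} Γ).symm p.2) (gen Γ m p.1) := by
  simp only [action, gen, MonoidHom.coe_mk, OneHom.coe_mk, Finsupp.lmapDomain_apply,
    Finsupp.mapDomain_single, Equiv.symm_apply_apply, mul_one, Equiv.apply_symm_apply]

variable {V : Type*} [AddCommGroup V] [Module ℂ V]

/-- The equivariant map from the free representation with given values on the generators. -/
noncomputable def lift (σ : Γ →* Module.End ℂ V) (x : Fin m → V) : FreeRep Γ m →ₗ[ℂ] V :=
  Finsupp.linearCombination ℂ fun p => σ ((equivShrink.{0} Γ).symm p.2) (x p.1)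

@[simp]
lemma lift_gen (σ : Γ →* Module.End ℂ V) (x : Fin m → V) (j : Fin m) :
    lift σ x (gen Γ m j) = x j := by
  simp [lift, gen]

lemma lift_action (σ : Γ →* Module.End ℂ V) (x : Fin m → V) (g : Γ) (a : FreeRep Γ m) :
    lift σ x (action Γ m g a) = σ g (lift σ x a) := by
  have : lift σ x ∘ₗ action Γ m g = σ g ∘ₗ lift σ x := by
    refine Finsupp.lhom_ext' fun p => LinearMap.ext_ring ?_
    simp [lift, action]
  exact LinearMap.congr_fun this a

/-- An equivariant map vanishing on the generators is zero. -/
lemma eq_zero_of_gen (σ : Γ →* Module.End ℂ V) (L : FreeRep Γ m →ₗ[ℂ] V)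
    (hL : ∀ g a, L (action Γ m g a) = σ g (L a)) (h : ∀ j, L (gen Γ m j) = 0) : L = 0 := by
  refine Finsupp.lhom_ext' fun p => LinearMap.ext_ring ?_
  simp [single_eq, hL, h]

end FreeRep

end FreeRep

end HigherT
namespace HigherT

/-! ### Spectral gaps. -/

section Gap

variable {Γ : Type u} [Group Γ] {V : Type} [NormedAddCommGroup V] [InnerProductSpace ℂ V]

/-- A lower bound for the displacement of vectors by the elements of a finite set. -/
def HasGap (ρ : UnitaryRep Γ V) (S : Finset Γ) (ε : ℝ) : Prop :=
  ∀ v, ε * ‖v‖ ^ 2 ≤ ∑ s ∈ S, ‖ρ s v - v‖ ^ 2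

lemma HasGap.of_dense {ρ : UnitaryRep Γ V} {S : Finset Γ} {ε : ℝ} {A : Set V} (hA : Dense A)
    (h : ∀ v ∈ A, ε * ‖v‖ ^ 2 ≤ ∑ s ∈ S, ‖ρ s v - v‖ ^ 2) : HasGap ρ S ε := by
  have hcl : IsClosed {v | ε * ‖v‖ ^ 2 ≤ ∑ s ∈ S, ‖ρ s v - v‖ ^ 2} := by
    refine isClosed_le (by fun_prop) (continuous_finsetSum _ fun s _ => ?_)
    exact (((ρ s).continuous.sub continuous_id).norm.pow 2)
  exact fun v => (hcl.closure_subset_iff.2 h) (hA v)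

end Gap

/-! ### The compact set of normalized forms. -/

section Forms

variable {Γ : Type u} [Group Γ] [Countable Γ] {m m' : ℕ}

local notation "ℚΓ" => MonoidAlgebra ℚ Γ

open FreeRep

/-- The normalized invariant positive semidefinite forms on the free representation that vanish
on the kernel of `D` and have a given displacement bound. -/
structure IsForm (D : (Fin m → ℚΓ) →ₗ[ℚΓ] (Fin m' → ℚΓ)) (S : Finset Γ) (ε : ℝ)
    (B : FreeRep Γ m → FreeRep Γ m → ℂ) : Prop where
  symm : ∀ a b, star (B b a) = B a b
  nonneg : ∀ a, 0 ≤ (B a a).re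
  add_left : ∀ a b c, B (a + b) c = B a c + B b c
  smul_left : ∀ a b (r : ℂ), B (r • a) b = star r * B a b
  inv : ∀ g a b, B (action Γ m g a) (action Γ m g b) = B a b
  norm_gen : ∑ j, (B (gen Γ m j) (gen Γ m j)).re = 1
  cocycle : ∀ y, D y = 0 →
    (B (ratEval (action Γ m) y (gen Γ m)) (ratEval (action Γ m) y (gen Γ m))).re = 0
  gap : ∀ a, ε * (B a a).re ≤ ∑ s ∈ S, (B (action Γ m s a - a) (action Γ m s a - a)).re

/-- The sum of squares of the adjoint of `D`, as a function on forms. -/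
noncomputable def adjointEnergy (D : (Fin m → ℚΓ) →ₗ[ℚΓ] (Fin m' → ℚΓ))
    (B : FreeRep Γ m → FreeRep Γ m → ℂ) : ℝ :=
  ∑ i, (B (ratEval (action Γ m) (adjointCoeff D i) (gen Γ m))
    (ratEval (action Γ m) (adjointCoeff D i) (gen Γ m))).re

variable {D : (Fin m → MonoidAlgebra ℚ Γ) →ₗ[MonoidAlgebra ℚ Γ] (Fin m' → MonoidAlgebra ℚ Γ)}
  {S : Finset Γ} {ε : ℝ}

section GramForm

variable {V : Type} [NormedAddCommGroup V] [InnerProductSpace ℂ V] {ρ : UnitaryRep Γ V}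

lemma inner_self_re (v : V) : (inner ℂ v v).re = ‖v‖ ^ 2 := by
  rw [inner_self_eq_norm_sq_to_K]; norm_cast

/-- The form pulled back along an equivariant map. -/
lemma isForm_gram (L : FreeRep Γ m →ₗ[ℂ] V) (hL : ∀ g a, L (action Γ m g a) = ρ g (L a))
    (hx : (fun j => L (gen Γ m j)) ∈ matrixCocycles ρ D) (hn : ∑ j, ‖L (gen Γ m j)‖ ^ 2 = 1)
    (hgap : HasGap ρ S ε) : IsForm D S ε fun a b => inner ℂ (L a) (L b) where
  symm a b := inner_conj_symm _ _
  nonneg a := by rw [inner_self_re]; positivity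
  add_left a b c := by rw [map_add, inner_add_left]
  smul_left a b r := by rw [map_smul, inner_smul_left]; rfl
  inv g a b := by rw [hL, hL, LinearIsometryEquiv.inner_map_map]
  norm_gen := by simpa only [inner_self_re] using hn
  cocycle y hy := by
    have : L (ratEval (action Γ m) y (gen Γ m)) = 0 := by
      rw [map_ratEval (action Γ m) ρ.toEnd L hL]
      exact hx y hy
    simp [this]
  gap a := by
    simp only [inner_self_re, map_sub, hL]
    exact hgap (L a)

lemma adjointEnergy_gram (L : FreeRep Γ m →ₗ[ℂ] V) (hL : ∀ g a, L (action Γ m g a) = ρ g (L a)) :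
    adjointEnergy D (fun a b => inner ℂ (L a) (L b)) =
      ∑ i, ‖ratEval ρ.toEnd (adjointCoeff D i) fun j => L (gen Γ m j)‖ ^ 2 := by
  simp only [adjointEnergy, inner_self_re, map_ratEval (action Γ m) ρ.toEnd L hL]

end GramForm

namespace IsForm

variable {B : FreeRep Γ m → FreeRep Γ m → ℂ}

/-- The semi-inner product given by a form. -/
@[reducible] def core (hB : IsForm D S ε B) : PreInnerProductSpace.Core ℂ (FreeRep Γ m) where
  inner := B
  conj_inner_symm := hB.symm
  re_inner_nonneg := hB.nonneg
  add_left := hB.add_left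
  smul_left a b r := hB.smul_left a b r

/-- A form comes from an equivariant map with dense range to a unitary representation. -/
lemma exists_rep (hB : IsForm D S ε B) :
    ∃ (U : Type) (_ : NormedAddCommGroup U) (_ : InnerProductSpace ℂ U) (_ : CompleteSpace U)
      (_ : TopologicalSpace.SeparableSpace U) (ρ : UnitaryRep Γ U) (L : FreeRep Γ m →ₗ[ℂ] U),
      DenseRange L ∧ (∀ g a, L (action Γ m g a) = ρ g (L a)) ∧
      (∀ a b, inner ℂ (L a) (L b) = B a b) ∧ (fun j => L (gen Γ m j)) ∈ matrixCocycles ρ D ∧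
      ∑ j, ‖L (gen Γ m j)‖ ^ 2 = 1 ∧ HasGap ρ S ε := by
  obtain ⟨U, _, _, _, ρ, L, hd, hL, hin⟩ := exists_gns (action Γ m) hB.core hB.inv
  have hin' : ∀ a b, inner ℂ (L a) (L b) = B a b := hin
  refine ⟨U, inferInstance, inferInstance, inferInstance, ?_, ρ, L, hd, hL, hin', ?_, ?_, ?_⟩
  -- The countably many translates of the generators span a dense subspace.
  · have : Countable (Shrink.{0} Γ) := (equivShrink.{0} Γ).symm.injective.countable
    have hc : (Set.range fun p => L (Finsupp.single p 1)).Countable := Set.countable_range _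
    have hs := (hc.isSeparable.span (R := ℂ)).closure
    rw [← TopologicalSpace.isSeparable_univ_iff]
    refine hs.mono ?_
    rw [← hd.closure_range]
    refine closure_mono ?_
    rintro _ ⟨a, rfl⟩
    have : a ∈ Submodule.span ℂ (Set.range fun p : Fin m × Shrink.{0} Γ => Finsupp.single p (1 : ℂ)) := by
      have := (Finsupp.basisSingleOne (R := ℂ) (ι := Fin m × Shrink.{0} Γ)).mem_span a
      simpa using this
    have h2 := Submodule.mem_map_of_mem (f := L) this
    rw [Submodule.map_span, ← Set.range_comp] at h2
    exact h2
  · intro y hy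
    change ratEval ρ.toEnd y _ = 0
    rw [← map_ratEval (action Γ m) ρ.toEnd L hL, ← norm_eq_zero, ← sq_eq_zero_iff, ← inner_self_re,
      hin']
    exact hB.cocycle y hy
  · simpa only [← inner_self_re, hin'] using hB.norm_gen
  · refine HasGap.of_dense hd ?_
    rintro _ ⟨a, rfl⟩
    simp only [← inner_self_re, ← hL, ← map_sub, hin']
    exact hB.gap a

/-- By normalization and invariance every translate of a generator has seminorm at most `1`; the
triangle inequality then bounds all vectors, uniformly in the form. -/
lemma exists_bound (a : FreeRep Γ m) :
    ∃ N : ℝ, ∀ B, IsForm D S ε B → √(B a a).re ≤ N := by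
  induction a using Finsupp.induction_linear with
  | zero =>
    refine ⟨0, fun B hB => ?_⟩
    have : B 0 0 = 0 := by simpa using hB.smul_left 0 0 0
    simp [this]
  | add a b ha hb =>
    obtain ⟨N, hN⟩ := ha
    obtain ⟨M, hM⟩ := hb
    refine ⟨N + M, fun B hB => ?_⟩
    let : SeminormedAddCommGroup (FreeRep Γ m) :=
      InnerProductSpace.Core.toSeminormedAddCommGroup (c := hB.core)
    exact (norm_add_le a b).trans (add_le_add (hN B hB) (hM B hB))
  | single p r =>
    refine ⟨‖r‖, fun B hB => ?_⟩
    have hle : (B (gen Γ m p.1) (gen Γ m p.1)).re ≤ 1 := by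
      rw [← hB.norm_gen]
      exact Finset.single_le_sum (f := fun j => (B (gen Γ m j) (gen Γ m j)).re)
        (fun j _ => hB.nonneg _) (Finset.mem_univ _)
    have hr : ∀ a b (r : ℂ), B a (r • b) = r * B a b := fun a b r => by
      rw [← hB.symm, hB.smul_left, star_mul, hB.symm, star_star, mul_comm]
    have : Finsupp.single p r = r • action Γ m ((equivShrink.{0} Γ).symm p.2) (gen Γ m p.1) := by
      rw [← single_eq]; simp
    rw [this, hB.smul_left, hr, hB.inv, ← mul_assoc, Complex.star_def, Complex.conj_mul']
    rw [← Complex.ofReal_pow, Complex.re_ofReal_mul]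
    refine (Real.sqrt_le_sqrt (mul_le_of_le_one_right (sq_nonneg _) hle)).trans_eq ?_
    exact Real.sqrt_sq (norm_nonneg r)

lemma norm_le (hB : IsForm D S ε B) (a b : FreeRep Γ m) :
    ‖B a b‖ ≤ √(B a a).re * √(B b b).re := by
  let := hB.core
  exact InnerProductSpace.Core.norm_inner_le_norm (𝕜 := ℂ) a b

end IsForm

lemma isClosed_setOf_isForm : IsClosed {B | IsForm D S ε B} := by
  have hev : ∀ a b, Continuous fun B : FreeRep Γ m → FreeRep Γ m → ℂ => B a b := fun a b =>
    continuous_apply_apply a b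
  have hre : ∀ a b, Continuous fun B : FreeRep Γ m → FreeRep Γ m → ℂ => (B a b).re := fun a b =>
    Complex.continuous_re.comp (hev a b)
  have : {B | IsForm D S ε B} =
      {B | ∀ a b, star (B b a) = B a b} ∩ {B | ∀ a, 0 ≤ (B a a).re} ∩
      {B | ∀ a b c, B (a + b) c = B a c + B b c} ∩
      {B | ∀ a b (r : ℂ), B (r • a) b = star r * B a b} ∩
      {B | ∀ g a b, B (action Γ m g a) (action Γ m g b) = B a b} ∩
      {B | ∑ j, (B (gen Γ m j) (gen Γ m j)).re = 1} ∩
      {B | ∀ y, D y = 0 →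
        (B (ratEval (action Γ m) y (gen Γ m)) (ratEval (action Γ m) y (gen Γ m))).re = 0} ∩
      {B | ∀ a, ε * (B a a).re ≤
        ∑ s ∈ S, (B (action Γ m s a - a) (action Γ m s a - a)).re} := by
    ext B
    simp only [Set.mem_inter_iff, Set.mem_ofPred_eq, and_assoc]
    exact ⟨fun ⟨h1, h2, h3, h4, h5, h6, h7, h8⟩ => ⟨h1, h2, h3, h4, h5, h6, h7, h8⟩,
      fun ⟨h1, h2, h3, h4, h5, h6, h7, h8⟩ => ⟨h1, h2, h3, h4, h5, h6, h7, h8⟩⟩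
  rw [this]
  simp only [Set.ofPred_forall]
  refine IsClosed.inter (IsClosed.inter (IsClosed.inter (IsClosed.inter (IsClosed.inter
    (IsClosed.inter (IsClosed.inter ?_ ?_) ?_) ?_) ?_) ?_) ?_) ?_
  · exact isClosed_iInter fun a => isClosed_iInter fun b => isClosed_eq (hev b a).star (hev a b)
  · exact isClosed_iInter fun a => isClosed_le continuous_const (hre a a)
  · exact isClosed_iInter fun a => isClosed_iInter fun b => isClosed_iInter fun c =>
      isClosed_eq (hev _ _) ((hev _ _).add (hev _ _))
  · exact isClosed_iInter fun a => isClosed_iInter fun b => isClosed_iInter fun r =>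
      isClosed_eq (hev _ _) (continuous_const.mul (hev _ _))
  · exact isClosed_iInter fun g => isClosed_iInter fun a => isClosed_iInter fun b =>
      isClosed_eq (hev _ _) (hev _ _)
  · exact isClosed_eq (continuous_finsetSum _ fun j _ => hre _ _) continuous_const
  · exact isClosed_iInter fun y => isClosed_iInter fun _ => isClosed_eq (hre _ _) continuous_const
  · exact isClosed_iInter fun a => isClosed_le (continuous_const.mul (hre _ _))
      (continuous_finsetSum _ fun s _ => hre _ _)

/-- By Cauchy–Schwarz and the uniform bounds, the forms are a closed subset of a product of discs,
compact by Tychonoff. The topology is that of pointwise convergence. -/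
lemma isCompact_setOf_isForm : IsCompact {B | IsForm D S ε B} := by
  choose N hN using fun a => IsForm.exists_bound (D := D) (S := S) (ε := ε) a
  have hc : IsCompact (Set.pi Set.univ fun a : FreeRep Γ m => Set.pi Set.univ fun b =>
      Metric.closedBall (0 : ℂ) (N a * N b)) :=
    isCompact_univ_pi fun a => isCompact_univ_pi fun b => isCompact_closedBall _ _
  refine hc.of_isClosed_subset isClosed_setOf_isForm fun B hB a _ b _ => ?_
  rw [mem_closedBall_zero_iff]
  exact (IsForm.norm_le hB a b).trans (mul_le_mul (hN a B hB) (hN b B hB) (Real.sqrt_nonneg _)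
    ((Real.sqrt_nonneg _).trans (hN a B hB)))

lemma continuous_adjointEnergy : Continuous (adjointEnergy D) :=
  continuous_finsetSum _ fun _ _ => Complex.continuous_re.comp (continuous_apply_apply _ _)

lemma adjointEnergy_nonneg {B : FreeRep Γ m → FreeRep Γ m → ℂ} (hB : IsForm D S ε B) :
    0 ≤ adjointEnergy D B :=
  Finset.sum_nonneg fun _ _ => hB.nonneg _

/-- If there are forms of arbitrarily small energy, there is an extreme form of energy zero. -/
lemma exists_extreme_form (h : ∀ δ > 0, ∃ B, IsForm D S ε B ∧ adjointEnergy D B ≤ δ) :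
    (Set.extremePoints ℝ {B | IsForm D S ε B ∧ adjointEnergy D B = 0}).Nonempty := by
  have hK := isCompact_setOf_isForm (D := D) (S := S) (ε := ε)
  -- Krein–Milman, applied to the compact set of zero-energy forms; compactness also makes the
  -- energy attain its minimum, which is `0` by hypothesis.
  refine IsCompact.extremePoints_nonempty ?_ ?_
  · exact hK.inter_right (isClosed_eq continuous_adjointEnergy continuous_const)
  · obtain ⟨B₁, hB₁, -⟩ := h 1 one_pos
    obtain ⟨B, hB, hmin⟩ := hK.exists_isMinOn ⟨B₁, hB₁⟩ continuous_adjointEnergy.continuousOn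
    refine ⟨B, hB, le_antisymm (le_of_forall_pos_le_add fun δ hδ => ?_) (adjointEnergy_nonneg hB)⟩
    obtain ⟨B', hB', hδ'⟩ := h δ hδ
    rw [zero_add]
    exact (hmin hB').trans hδ'

end Forms

end HigherT
namespace HigherT

/-! ### Extreme forms generate irreducible representations. -/

section Irreducible

variable {Γ : Type u} [Group Γ] {V : Type} [NormedAddCommGroup V] [InnerProductSpace ℂ V]

/-- The orthogonal projection to a closed invariant subspace is equivariant. -/
lemma starProjection_apply_rep (ρ : UnitaryRep Γ V) (W : Submodule ℂ V) [W.HasOrthogonalProjection]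
    (hW : ∀ (g : Γ), ∀ w ∈ W, ρ g w ∈ W) (g : Γ) (v : V) :
    W.starProjection (ρ g v) = ρ g (W.starProjection v) := by
  refine W.eq_starProjection_of_mem_of_inner_eq_zero
    (hW g _ (W.starProjection_apply_mem v)) fun w hw => ?_
  rw [← map_sub, ρ.inner_apply_left]
  exact W.starProjection_inner_eq_zero v _ (hW _ _ hw)

variable [Countable Γ] {m m' : ℕ} {S : Finset Γ} {ε : ℝ}
  {D : (Fin m → MonoidAlgebra ℚ Γ) →ₗ[MonoidAlgebra ℚ Γ] (Fin m' → MonoidAlgebra ℚ Γ)}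

open FreeRep

/-- A normalized vector family compressed by an equivariant bounded operator gives a form. -/
lemma isForm_compress {ρ : UnitaryRep Γ V} {L : FreeRep Γ m →ₗ[ℂ] V}
    (hL : ∀ g a, L (action Γ m g a) = ρ g (L a))
    (hx : (fun j => L (gen Γ m j)) ∈ matrixCocycles ρ D)
    (hE : adjointEnergy D (fun a b => inner ℂ (L a) (L b)) = 0)
    (hgap : HasGap ρ S ε) (P : V →L[ℂ] V) (hP : ∀ g v, P (ρ g v) = ρ g (P v)) {t : ℝ}
    (ht : 0 < t) (htP : ∑ j, ‖P (L (gen Γ m j))‖ ^ 2 = t) :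
    (fun a b => ((t⁻¹ : ℝ) : ℂ) * inner ℂ (P (L a)) (P (L b))) ∈
      {B | IsForm D S ε B ∧ adjointEnergy D B = 0} := by
  -- Scaling by `1/√t` restores the normalization, so the form is the Gram form of `c • (P ∘ L)`.
  let c : ℂ := ((√t)⁻¹ : ℝ)
  have hc : star c * c = ((t⁻¹ : ℝ) : ℂ) := by
    rw [Complex.star_def, Complex.conj_ofReal, ← Complex.ofReal_mul, ← mul_inv,
      Real.mul_self_sqrt ht.le]
  have hcn : ‖c‖ ^ 2 = t⁻¹ := by
    rw [Complex.norm_real, Real.norm_eq_abs, sq_abs, inv_pow, Real.sq_sqrt ht.le]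
  let L' : FreeRep Γ m →ₗ[ℂ] V := c • (P.toLinearMap ∘ₗ L)
  have hL'a : ∀ a, L' a = c • P (L a) := fun a => rfl
  have hL' : ∀ g a, L' (action Γ m g a) = ρ g (L' a) := fun g a => by
    rw [hL'a, hL'a, hL, hP, map_smul]
  have hB : (fun a b => ((t⁻¹ : ℝ) : ℂ) * inner ℂ (P (L a)) (P (L b))) =
      fun a b => inner ℂ (L' a) (L' b) := by
    funext a b
    rw [hL'a, hL'a, inner_smul_left, inner_smul_right, ← mul_assoc, ← hc]
    rfl
  have hev : ∀ y : Fin m → MonoidAlgebra ℚ Γ, ratEval ρ.toEnd y (fun j => L' (gen Γ m j)) =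
      c • P (ratEval ρ.toEnd y fun j => L (gen Γ m j)) := fun y => by
    rw [← map_ratEval (action Γ m) ρ.toEnd L' hL', ← map_ratEval (action Γ m) ρ.toEnd L hL, hL'a]
  rw [hB]
  refine ⟨isForm_gram L' hL' ?_ ?_ hgap, ?_⟩
  · intro y hy
    have := hev y
    rw [show (ratEval ρ.toEnd y fun j => L (gen Γ m j)) = 0 from hx y hy, map_zero,
      smul_zero] at this
    exact this
  · simp only [hL'a, norm_smul, mul_pow, hcn, ← Finset.mul_sum, htP]
    exact inv_mul_cancel₀ ht.ne'
  · rw [adjointEnergy_gram L hL, Finset.sum_eq_zero_iff_of_nonneg fun _ _ => sq_nonneg _] at hE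
    rw [adjointEnergy_gram L' hL']
    refine Finset.sum_eq_zero fun i hi => ?_
    have := hE i hi
    rw [sq_eq_zero_iff, norm_eq_zero] at this
    rw [hev, this]
    simp

/-- The representation generated by an extreme form is irreducible. -/
lemma isIrreducible_of_extreme [CompleteSpace V] {ρ : UnitaryRep Γ V} {L : FreeRep Γ m →ₗ[ℂ] V} (hd : DenseRange L)
    (hL : ∀ g a, L (action Γ m g a) = ρ g (L a))
    (hx : (fun j => L (gen Γ m j)) ∈ matrixCocycles ρ D) (hn : ∑ j, ‖L (gen Γ m j)‖ ^ 2 = 1)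
    (hgap : HasGap ρ S ε)
    (hB : (fun a b => inner ℂ (L a) (L b)) ∈
      Set.extremePoints ℝ {B | IsForm D S ε B ∧ adjointEnergy D B = 0}) :
    IsIrreducible ρ := by
  constructor
  · by_contra hV
    rw [not_nontrivial_iff_subsingleton] at hV
    have : ∀ v : V, v = 0 := fun v => Subsingleton.elim _ _
    simp [this (L _)] at hn
  intro W hW hinv
  have : CompleteSpace W := hW.completeSpace_coe
  have hext : ∀ {P Q : V →L[ℂ] V}, (∀ a, P (L a) = Q (L a)) → P = Q := fun {P Q} h =>
    ContinuousLinearMap.coeFn_injective (hd.equalizer P.continuous Q.continuous (funext h))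
  have hzero : ∀ P : V →L[ℂ] V, (∀ g v, P (ρ g v) = ρ g (P v)) →
      ∑ j, ‖P (L (gen Γ m j))‖ ^ 2 = 0 → P = 0 := fun P hP h0 => by
    rw [Finset.sum_eq_zero_iff_of_nonneg fun _ _ => sq_nonneg _] at h0
    have : P.toLinearMap ∘ₗ L = 0 := by
      refine eq_zero_of_gen ρ.toEnd _ (fun g a => ?_) fun j => ?_
      · simp only [LinearMap.comp_apply, hL]; exact hP g _
      · have := h0 j (Finset.mem_univ j)
        rwa [sq_eq_zero_iff, norm_eq_zero] at this
    exact hext fun a => LinearMap.congr_fun this a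
  let P := W.starProjection
  let Q := ContinuousLinearMap.id ℂ V - P
  have hP : ∀ g v, P (ρ g v) = ρ g (P v) := starProjection_apply_rep ρ W hinv
  have hQ : ∀ g v, Q (ρ g v) = ρ g (Q v) := fun g v => by simp [Q, hP]
  have horth : ∀ u v, inner ℂ (P u) (Q v) = 0 := fun u v =>
    inner_eq_zero_symm.1 (W.starProjection_inner_eq_zero v _ (W.starProjection_apply_mem u))
  have hPQ : ∀ u v, inner ℂ (P u) (P v) + inner ℂ (Q u) (Q v) = inner ℂ u v := fun u v => by
    have h1 := horth u v
    have h2 : inner ℂ (Q u) (P v) = 0 := inner_eq_zero_symm.1 (horth v u)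
    have h3 : ∀ w, w = P w + Q w := fun w => by simp [Q]
    conv_rhs => rw [h3 u, h3 v]
    rw [inner_add_left, inner_add_right, inner_add_right, h1, h2]
    ring
  have hPQn : ∀ u, ‖P u‖ ^ 2 + ‖Q u‖ ^ 2 = ‖u‖ ^ 2 := fun u => by
    rw [← inner_self_re, ← inner_self_re, ← inner_self_re, ← Complex.add_re, hPQ]
  set t := ∑ j, ‖P (L (gen Γ m j))‖ ^ 2 with ht
  set s := ∑ j, ‖Q (L (gen Γ m j))‖ ^ 2 with hs
  have hts : t + s = 1 := by
    rw [← hn, ht, hs, ← Finset.sum_add_distrib]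
    exact Finset.sum_congr rfl fun j _ => hPQn _
  have ht0 : 0 ≤ t := Finset.sum_nonneg fun _ _ => sq_nonneg _
  have hs0 : 0 ≤ s := Finset.sum_nonneg fun _ _ => sq_nonneg _
  rcases ht0.eq_or_lt with h | htpos
  · left
    have hP0 := hzero P hP h.symm
    rw [eq_bot_iff]
    intro w hw
    have : P w = w := Submodule.starProjection_eq_self_iff.2 hw
    rw [← this, hP0]; simp
  rcases hs0.eq_or_lt with h | hspos
  · right
    have hQ0 := hzero Q hQ h.symm
    rw [eq_top_iff]
    intro w _
    have : Q w = 0 := by rw [hQ0]; rfl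
    rw [← Submodule.starProjection_eq_self_iff]
    exact (sub_eq_zero.1 this).symm
  left
  have hE := hB.1.2
  have h1 := isForm_compress hL hx hE hgap P hP htpos rfl
  have h2 := isForm_compress hL hx hE hgap Q hQ hspos rfl
  -- Compressing to `W` and to its complement writes the form as a convex combination with weights
  -- `t` and `s`. Extremality makes the first compression equal to the form itself, so `P` is the
  -- scalar `t`; as `P` fixes `W` and `t < 1`, this forces `W = 0`.
  have h3 := hB.2 h1 h2 ⟨t, s, htpos, hspos, hts, by
    funext a b
    simp only [Pi.add_apply, Pi.smul_apply, Complex.real_smul, ← mul_assoc, ← Complex.ofReal_mul,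
      mul_inv_cancel₀ htpos.ne', mul_inv_cancel₀ hspos.ne', Complex.ofReal_one, one_mul]
    exact hPQ _ _⟩
  have h4 : ∀ a b, inner ℂ (P (L a)) (L b) = inner ℂ ((t : ℂ) • L a) (L b) := fun a b => by
    have e1 := congrFun (congrFun h3 a) b
    have e2 : inner ℂ (P (L a)) (L b) = inner ℂ (P (L a)) (P (L b)) := by
      rw [← sub_eq_zero, ← inner_sub_right]; exact horth _ _
    rw [e2, inner_smul_left, Complex.conj_ofReal, ← e1, ← mul_assoc, ← Complex.ofReal_mul,
      mul_inv_cancel₀ htpos.ne', Complex.ofReal_one, one_mul]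
  have h5 : P = (t : ℂ) • ContinuousLinearMap.id ℂ V := hext fun a => by
    have e1 : (fun v => inner ℂ (P (L a)) v) = fun v => inner ℂ ((t : ℂ) • L a) v :=
      hd.equalizer (by fun_prop) (by fun_prop) (funext fun b => h4 a b)
    exact ext_inner_right ℂ fun v => congrFun e1 v
  rw [eq_bot_iff]
  intro w hw
  have h6 : P w = w := Submodule.starProjection_eq_self_iff.2 hw
  rw [h5] at h6
  have h7 : (1 - (t : ℂ)) • w = 0 := by
    rw [sub_smul, one_smul, sub_eq_zero]; exact h6.symm
  rcases smul_eq_zero.1 h7 with h8 | h8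
  · have : s = 0 := by
      have : (1 - t : ℝ) = 0 := by exact_mod_cast h8
      linarith
    exact absurd this hspos.ne'
  · exact h8

end Irreducible

/-! ### From cohomology to reduced cohomology of an irreducible representation. -/

section Main

variable {Γ : Type u} [Group Γ] [Countable Γ] {V : Type} [NormedAddCommGroup V]
  [InnerProductSpace ℂ V] [CompleteSpace V]

open FreeRep

/-- If some unitary representation has cohomology in degree `k + 1`, then some irreducible one has
reduced cohomology in this degree, and satisfies the same displacement bound. -/
theorem exists_irreducible_of_cohomology {n : ℕ} (hΓ : IsFPRat Γ n) (k : ℕ) (hk : k + 1 ≤ n)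
    (ρ : UnitaryRep Γ V) {S : Finset Γ} {ε : ℝ} (hgap : HasGap ρ S ε)
    (hρ : ¬ Subsingleton (Cohomology ρ (k + 1))) :
    ∃ (U : Type) (_ : NormedAddCommGroup U) (_ : InnerProductSpace ℂ U) (_ : CompleteSpace U)
      (_ : TopologicalSpace.SeparableSpace U) (π : UnitaryRep Γ U), IsIrreducible π ∧
      HasGap π S ε ∧ ¬ Subsingleton (ReducedCohomology π (k + 1)) := by
  obtain ⟨m, m', D, hD⟩ := exists_matrix hΓ k hk
  have h1 : ¬ matrixCocycles ρ D ⊆ Set.range (matrixDual ρ D) := fun h =>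
    hρ ((subsingleton_cohomology_iff ρ _).2 ((hD V ρ).1 h))
  obtain ⟨B, hB⟩ := exists_extreme_form (D := D) (S := S) (ε := ε) fun δ hδ => by
    obtain ⟨x, hx, hn, hxδ⟩ := exists_almostHarmonic ρ D h1 hδ
    have hL := lift_action (m := m) ρ.toEnd x
    refine ⟨fun a b => inner ℂ (lift ρ.toEnd x a) (lift ρ.toEnd x b),
      isForm_gram _ hL ?_ ?_ hgap, ?_⟩
    · simpa only [lift_gen] using hx
    · simpa only [lift_gen] using hn
    · rw [adjointEnergy_gram (ρ := ρ) _ hL]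
      simpa only [lift_gen] using hxδ
  obtain ⟨U, _, _, _, _, π, L, hd, hL, hin, hx, hn, hgap'⟩ := hB.1.1.exists_rep
  have hBL : (fun a b => inner ℂ (L a) (L b)) = B := by funext a b; exact hin a b
  rw [← hBL] at hB
  refine ⟨U, inferInstance, inferInstance, inferInstance, inferInstance, π,
    isIrreducible_of_extreme hd hL hx hn hgap' hB, hgap', fun hsub => ?_⟩
  have hcl := (hD U π).2 (cocycles_subset_closure_coboundaries π _ hsub) hx
  have hE := hB.1.2
  rw [adjointEnergy_gram (ρ := π) L hL,
    Finset.sum_eq_zero_iff_of_nonneg fun _ _ => sq_nonneg _] at hE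
  -- Zero energy makes the generating cocycle orthogonal to all coboundaries, hence to their
  -- closure. If the reduced cohomology vanished, it would be orthogonal to itself, although its
  -- norm is `1`.
  have hclosed : IsClosed {y : Fin m → U | ∑ j, inner ℂ (y j) (L (gen Γ m j)) = 0} :=
    isClosed_eq (by fun_prop) continuous_const
  have h0 : (fun j => L (gen Γ m j)) ∈
      {y : Fin m → U | ∑ j, inner ℂ (y j) (L (gen Γ m j)) = 0} := by
    refine hclosed.closure_subset_iff.2 ?_ hcl
    rintro _ ⟨w, rfl⟩
    change ∑ j, inner ℂ (matrixDual π D w j) (L (gen Γ m j)) = 0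
    rw [sum_inner_matrixDual π D w (fun j => L (gen Γ m j))]
    refine Finset.sum_eq_zero fun i hi => ?_
    have := hE i hi
    rw [sq_eq_zero_iff, norm_eq_zero] at this
    rw [this, inner_zero_right]
  have h2 := congrArg Complex.re (show ∑ j, inner ℂ (L (gen Γ m j)) (L (gen Γ m j)) = 0 from h0)
  rw [Complex.re_sum] at h2
  simp only [inner_self_re, hn, Complex.zero_re] at h2
  exact one_ne_zero h2

end Main

end HigherT
namespace HigherT

/-! ### Finite generation of `Γ`. -/

section FG

variable {Γ : Type u} [Group Γ]

lemma finitePresentation_of_isFPRat {n : ℕ} (hΓ : IsFPRat Γ n) (hn : 1 ≤ n) :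
    Module.FinitePresentation (MonoidAlgebra ℚ Γ)
      (Representation.trivial ℚ Γ (ULift.{u} ℚ)).asModule := by
  obtain ⟨P, hP⟩ := hΓ
  have fin0 := hP 0 (Nat.zero_le n)
  have fin1 := hP 1 hn
  have proj0 : Module.Projective (MonoidAlgebra ℚ Γ) (P.complex.X 0) :=
    (IsProjective.iff_projective _).2 (P.projective 0)
  have fp := Module.finitePresentation_of_projective (MonoidAlgebra ℚ Γ) (P.complex.X 0)
  let l : P.complex.X 0 →ₗ[MonoidAlgebra ℚ Γ]
    (Representation.trivial ℚ Γ (ULift.{u} ℚ)).asModule := (P.π.f 0).hom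
  have hl : Function.Surjective l :=
    (ModuleCat.epi_iff_surjective (P.π.f 0)).1 inferInstance
  refine Module.finitePresentation_of_surjective l hl ?_
  have h1 : LinearMap.range (P.complex.d 1 0).hom = LinearMap.ker l :=
    P.exact₀.moduleCat_range_eq_ker
  rw [← h1]
  rw [LinearMap.range_eq_map]
  exact fin1.fg_top.map _

/-- A group of type `FP₁` over `ℚ` is finitely generated. -/
lemma exists_finset_closure_eq_top {n : ℕ} (hΓ : IsFPRat Γ n) (hn : 1 ≤ n) :
    ∃ S : Finset Γ, Subgroup.closure (S : Set Γ) = ⊤ := by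
  classical
  have fp := finitePresentation_of_isFPRat hΓ hn
  let M := (Representation.trivial ℚ Γ (ULift.{u} ℚ)).asModule
  let aug : MonoidAlgebra ℚ Γ →ₗ[MonoidAlgebra ℚ Γ] M :=
    barAug Γ ∘ₗ Finsupp.lsingle Fin.elim0
  have haug (g : Γ) (q : ℚ) : aug (MonoidAlgebra.single g q) =
      (Representation.trivial ℚ Γ (ULift.{u} ℚ)).asModuleEquiv.symm ⟨q⟩ :=
    barAug_single _ g q
  have hsurj : Function.Surjective aug := fun x =>
    ⟨MonoidAlgebra.single 1 ((Representation.trivial ℚ Γ (ULift.{u} ℚ)).asModuleEquiv x).down, by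
      rw [haug]; exact LinearEquiv.symm_apply_apply _ x⟩
  obtain ⟨T, hT⟩ := Module.FinitePresentation.fg_ker aug hsurj
  -- The supports of generators of the augmentation ideal generate `Γ`: with `H` the subgroup they
  -- generate, the map to `ℚ[Γ/H]` kills each `γ t`, whose support lies in one coset and whose
  -- coefficients sum to zero. Applied to `g - 1`, this gives `gH = H`.
  let S : Finset Γ := T.biUnion fun t => t.coeff.support
  refine ⟨S, (Subgroup.eq_top_iff' _).2 fun g => ?_⟩
  let H := Subgroup.closure (S : Set Γ)
  let θ : MonoidAlgebra ℚ Γ →+ ((Γ ⧸ H) →₀ ℚ) :=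
    (Finsupp.mapDomain.addMonoidHom (fun γ : Γ => (γ : Γ ⧸ H))).comp
      MonoidAlgebra.coeffAddEquiv.toAddMonoidHom
  have hθ (γ : Γ) (q : ℚ) : θ (MonoidAlgebra.single γ q) = Finsupp.single (γ : Γ ⧸ H) q := by
    simp [θ]
  have hker : ∀ x ∈ LinearMap.ker aug, ∀ a, θ (a * x) = 0 := by
    intro x hx
    rw [← hT] at hx
    induction hx using Submodule.span_induction with
    | zero => simp
    | add x y _ _ hx hy => intro a; rw [mul_add, map_add, hx, hy, add_zero]
    | smul r x _ hx => intro a; rw [smul_eq_mul, ← mul_assoc, hx]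
    | mem t ht =>
      have htsum : t = ∑ s ∈ t.coeff.support, MonoidAlgebra.single s (t.coeff s) :=
        (MonoidAlgebra.sum_coeff_single t).symm
      have h0 : ∑ s ∈ t.coeff.support, t.coeff s = 0 := by
        have h1 : aug t = 0 := LinearMap.mem_ker.1 (hT ▸ Submodule.subset_span ht)
        rw [htsum, map_sum] at h1
        simp only [haug] at h1
        have h2 := congrArg (fun m => (AddEquiv.ulift : ULift.{u} ℚ ≃+ ℚ)
          ((Representation.trivial ℚ Γ (ULift.{u} ℚ)).asModuleEquiv m)) h1
        simp only [map_sum, map_zero, LinearEquiv.apply_symm_apply] at h2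
        exact h2
      intro a
      induction a using MonoidAlgebra.induction_linear with
      | zero => simp
      | add a b ha hb => rw [add_mul, map_add, ha, hb, add_zero]
      | single γ q =>
        rw [htsum, Finset.mul_sum, map_sum]
        have (s) (hs : s ∈ t.coeff.support) :
            θ (MonoidAlgebra.single γ q * MonoidAlgebra.single s (t.coeff s)) =
              Finsupp.single (γ : Γ ⧸ H) (q * t.coeff s) := by
          rw [MonoidAlgebra.single_mul_single, hθ, QuotientGroup.mk_mul_of_mem]
          exact Subgroup.subset_closure (Finset.mem_biUnion.2 ⟨t, ht, hs⟩)
        rw [Finset.sum_congr rfl this, ← Finsupp.single_finsetSum, ← Finset.mul_sum, h0, mul_zero,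
          Finsupp.single_zero]
  have h1 := hker (MonoidAlgebra.single g 1 - MonoidAlgebra.single 1 1)
    (by rw [LinearMap.mem_ker, map_sub, haug, haug, sub_self]) 1
  rw [one_mul, map_sub, hθ, hθ, sub_eq_zero] at h1
  have h2 := (QuotientGroup.eq (s := H)).1
    (Finsupp.single_left_injective (one_ne_zero (α := ℚ)) h1.symm)
  simpa using h2

end FG

/-! ### First cohomology and spectral gaps. -/

section DegreeOne

variable {Γ : Type u} [Group Γ] {V : Type} [NormedAddCommGroup V] [InnerProductSpace ℂ V]

lemma d_zero_apply (ρ : UnitaryRep Γ V) (w : Cochain Γ V 0) (g : Fin 1 → Γ) :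
    d ρ 0 w g = ρ (g 0) (w Fin.elim0) - w Fin.elim0 := by
  have h (x : Fin 0 → Γ) : x = Fin.elim0 := Subsingleton.elim _ _
  simp [d, h, sub_eq_add_neg]

lemma d_one_apply (ρ : UnitaryRep Γ V) (c : Cochain Γ V 1) (g : Fin 2 → Γ) :
    d ρ 1 c g = ρ (g 0) (c fun _ => g 1) - c (fun _ => g 0 * g 1) + c fun _ => g 0 := by
  have h0 : Fin.contractNth 0 (· * ·) g = fun _ => g 0 * g 1 := by
    funext i; fin_cases i; rfl
  have h1 : Fin.contractNth 1 (· * ·) g = fun _ => g 0 := by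
    funext i; fin_cases i; rfl
  have h2 : (fun i : Fin 1 => g i.succ) = fun _ => g 1 := by
    funext i; fin_cases i; rfl
  simp [d, Fin.sum_univ_two, h0, h1, h2, sub_eq_add_neg, add_assoc]

/-- The first cohomology vanishes if and only if every crossed homomorphism is inner. -/
lemma subsingleton_cohomology_one_iff (ρ : UnitaryRep Γ V) :
    Subsingleton (Cohomology ρ 1) ↔
      ∀ b : Γ → V, (∀ g h, b (g * h) = b g + ρ g (b h)) → ∃ v, ∀ g, b g = ρ g v - v := by
  rw [subsingleton_cohomology_iff]
  constructor
  · intro h b hb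
    have hc : (fun g : Fin 1 → Γ => b (g 0)) ∈ cocycles ρ 1 := by
      rw [cocycles, LinearMap.mem_ker]
      funext g
      rw [d_one_apply, hb]
      simp
    obtain ⟨w, hw⟩ := h hc
    exact ⟨w Fin.elim0, fun g => by
      rw [← d_zero_apply ρ w (fun _ => g), hw]⟩
  · intro h c hc
    obtain ⟨v, hv⟩ := h (fun g => c fun _ => g) fun g h => by
      have h1 := congrFun (LinearMap.mem_ker.1 hc) ![g, h]
      rw [d_one_apply] at h1
      simp only [Matrix.cons_val_zero, Matrix.cons_val_one, Pi.zero_apply] at h1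
      rw [← sub_eq_zero, ← neg_eq_zero, ← h1]
      abel
    refine ⟨fun _ => v, funext fun g => ?_⟩
    rw [d_zero_apply, ← hv]
    congr 1
    funext i; fin_cases i; rfl

/-- Crossed homomorphisms are homomorphisms to the torsion-free abelian group `V`, so they factor
through a finite group and vanish. -/
lemma subsingleton_cohomology_one_of_isTrivial [Finite (Abelianization Γ)] {ρ : UnitaryRep Γ V}
    (hρ : IsTrivial ρ) : Subsingleton (Cohomology ρ 1) := by
  refine (subsingleton_cohomology_one_iff ρ).2 fun b hb => ⟨0, fun g => ?_⟩
  let f : Γ →* Multiplicative V := MonoidHom.mk' (fun g => Multiplicative.ofAdd (b g)) fun g h => by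
    rw [hb, hρ g]; rfl
  have h1 : f g = Abelianization.lift f (Abelianization.of g) := by simp
  have h2 : (f g) ^ Nat.card (Abelianization Γ) = 1 := by
    rw [h1, ← map_pow, pow_card_eq_one', map_one]
  have h3 : Nat.card (Abelianization Γ) • b g = 0 := h2
  have : b g = 0 := by
    rw [← Nat.cast_smul_eq_nsmul ℂ, smul_eq_zero] at h3
    exact h3.resolve_left (Nat.cast_ne_zero.2 Nat.card_pos.ne')
  rw [this, map_zero, sub_zero]

/-- If the first cohomology of a representation without invariant vectors vanishes, then a finite
generating set moves all unit vectors by a definite amount. -/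
lemma exists_hasGap [CompleteSpace V] {ρ : UnitaryRep Γ V} (hinv : NoInvariantVectors ρ)
    (h1 : Subsingleton (Cohomology ρ 1)) {S : Finset Γ}
    (hS : Subgroup.closure (S : Set Γ) = ⊤) : ∃ ε > 0, HasGap ρ S ε := by
  rw [subsingleton_cohomology_one_iff] at h1
  have hmem (g : Γ) : g ∈ Subgroup.closure (S : Set Γ) := hS ▸ Subgroup.mem_top g
  let T₀ : V →L[ℂ] (S → V) :=
    ContinuousLinearMap.pi fun s => ((ρ s).toContinuousLinearEquiv : V →L[ℂ] V) - .id ℂ V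
  let T : V →L[ℂ] PiLp 2 fun _ : S => V :=
    ((PiLp.continuousLinearEquiv 2 ℂ fun _ : S => V).symm : _ →L[ℂ] _) ∘L T₀
  have hT (v : V) (s : S) : T v s = ρ s v - v := rfl
  have hinj : Function.Injective T := by
    refine (injective_iff_map_eq_zero T).2 fun v hv => hinv v fun g => ?_
    induction hmem g using Subgroup.closure_induction with
    | mem s hs => exact sub_eq_zero.1 ((hT v ⟨s, hs⟩).symm.trans (by rw [hv]; rfl))
    | one => simp
    | mul g h _ _ hg hh => simp [hh, hg]
    | inv g _ hg =>
      conv_lhs => rw [← hg]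
      simp
  -- If the displacements `ρ s v_i - v_i` converge for the generators, they converge for every `g`,
  -- and the limit is a crossed homomorphism. It is inner by the vanishing of `H^1`, so the limit
  -- lies in the range. A bounded injective operator with closed range is bounded below.
  have hclosed : IsClosed (Set.range T) := by
    refine isClosed_of_closure_subset fun y hy => ?_
    obtain ⟨x, hx, hxy⟩ := mem_closure_iff_seq_limit.1 hy
    choose v hv using hx
    obtain rfl : (fun i => T (v i)) = x := funext hv
    have hconv (g : Γ) : ∃ z, Filter.Tendsto (fun i => ρ g (v i) - v i) Filter.atTop (nhds z) := by
      induction hmem g using Subgroup.closure_induction with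
      | mem s hs =>
        exact ⟨y ⟨s, hs⟩, ((PiLp.continuous_apply 2 (fun _ : S => V) ⟨s, hs⟩).tendsto y).comp hxy⟩
      | one => exact ⟨0, by simp⟩
      | mul g h _ _ hg hh =>
        obtain ⟨a, ha⟩ := hg
        obtain ⟨b, hb⟩ := hh
        refine ⟨a + ρ g b, (ha.add (((ρ g).continuous.tendsto b).comp hb)).congr fun i => ?_⟩
        simp
      | inv g _ hg =>
        obtain ⟨a, ha⟩ := hg
        refine ⟨- ρ g⁻¹ a, ((((ρ g⁻¹).continuous.tendsto a).comp ha).neg).congr fun i => ?_⟩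
        simp
    choose b hb using hconv
    obtain ⟨w, hw⟩ := h1 b fun g h => tendsto_nhds_unique (hb (g * h))
      (((hb g).add (((ρ g).continuous.tendsto _).comp (hb h))).congr fun i => by simp)
    refine ⟨w, PiLp.ext fun s => ?_⟩
    rw [hT, ← hw]
    exact tendsto_nhds_unique (hb s) (((PiLp.continuous_apply 2 _ s).tendsto y).comp hxy)
  obtain ⟨K, hK⟩ := T.antilipschitz_of_injective_of_isClosed_range hinj hclosed
  -- The constant `K` may be zero, so `K + 1` is inverted.
  refine ⟨1 / ((K : ℝ) + 1) ^ 2, by positivity, fun v => ?_⟩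
  have h2 : ‖v‖ ≤ K * ‖T v‖ := by
    simpa using hK.le_mul_dist v 0
  have h3 : ‖T v‖ ^ 2 = ∑ s ∈ S, ‖ρ s v - v‖ ^ 2 := by
    rw [PiLp.norm_sq_eq_of_L2, ← Finset.sum_coe_sort S]
    rfl
  rw [← h3, one_div, inv_mul_le_iff₀ (by positivity), ← mul_pow]
  gcongr
  exact h2.trans (by gcongr; linarith)

end DegreeOne

end HigherT
namespace HigherT

/-! ### A diagonal representation on `ℓ²` with non-vanishing first cohomology. -/

section Diagonal

open scoped ENNReal

instance : TopologicalSpace.SeparableSpace (lp (fun _ : ℕ => ℂ) 2) := by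
  let s : Set (lp (fun _ : ℕ => ℂ) 2) := Set.range fun i => lp.single 2 i 1
  have hs : TopologicalSpace.IsSeparable (Submodule.span ℂ s : Set (lp (fun _ : ℕ => ℂ) 2)) :=
    (Set.countable_range _).isSeparable.span
  have hd : closure (Submodule.span ℂ s : Set (lp (fun _ : ℕ => ℂ) 2)) = Set.univ := by
    refine Set.eq_univ_of_forall fun f => ?_
    refine mem_closure_of_tendsto (lp.hasSum_single ENNReal.ofNat_ne_top f)
      (Filter.Eventually.of_forall fun t => Submodule.sum_mem _ fun i _ => ?_)
    have : lp.single 2 i (f i) = f i • (lp.single 2 i 1 : lp (fun _ : ℕ => ℂ) 2) := by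
      rw [← lp.single_smul, smul_eq_mul, mul_one]
    rw [this]
    exact Submodule.smul_mem _ _ (Submodule.subset_span ⟨i, rfl⟩)
  exact TopologicalSpace.isSeparable_univ_iff.1 (hd ▸ hs.closure)

/-- Pointwise multiplication by a sequence of unit complex numbers. -/
noncomputable def diagLinear (z : ℕ → Circle) :
    lp (fun _ : ℕ => ℂ) 2 →ₗ[ℂ] lp (fun _ : ℕ => ℂ) 2 where
  toFun f := ⟨fun i => z i * f i, (lp.memℓp f).mono' fun i => by simp [Circle.norm_coe]⟩
  map_add' f f' := lp.ext <| funext fun i => mul_add _ _ _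
  map_smul' c f := lp.ext <| funext fun i => mul_left_comm _ _ _

@[simp]
lemma diagLinear_apply (z : ℕ → Circle) (f : lp (fun _ : ℕ => ℂ) 2) (i : ℕ) :
    diagLinear z f i = z i * f i := rfl

/-- The group of sequences of unit complex numbers acts on `ℓ²` by isometries. -/
noncomputable def diag : (ℕ → Circle) →* (lp (fun _ : ℕ => ℂ) 2 ≃ₗᵢ[ℂ] lp (fun _ : ℕ => ℂ) 2) where
  toFun z :=
    { toLinearEquiv := LinearEquiv.ofLinearMap (diagLinear z) (diagLinear z⁻¹)
        (LinearMap.ext fun f => lp.ext <| funext fun i => by simp)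
        (LinearMap.ext fun f => lp.ext <| funext fun i => by simp)
      norm_map' := fun f => by
        have h2 : (0 : ℝ) < (2 : ℝ≥0∞).toReal := by norm_num
        rw [lp.norm_eq_tsum_rpow h2, lp.norm_eq_tsum_rpow h2]
        simp [Circle.norm_coe] }
  map_one' := LinearIsometryEquiv.ext fun f => lp.ext <| funext fun i => by simp
  map_mul' z w := LinearIsometryEquiv.ext fun f => lp.ext <| funext fun i => by simp [mul_assoc]

@[simp]
lemma diag_apply (z : ℕ → Circle) (f : lp (fun _ : ℕ => ℂ) 2) (i : ℕ) :
    diag z f i = z i * f i := rfl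

variable {Γ : Type u} [Group Γ]

lemma norm_circle_exp_sub_one_le (x : ℝ) : ‖(Circle.exp x : ℂ) - 1‖ ≤ |x| := by
  rw [Circle.coe_exp, mul_comm]
  exact Real.norm_exp_I_mul_ofReal_sub_one_le

/-- The angles of a diagonal representation which almost has invariant vectors. -/
noncomputable def angles (x : ℝ) (m : ℕ) : Circle := Circle.exp (x * (1 / 2) ^ m)

/-- The angle `2^(-m)` lies in `(0, 1]`, so it is not a multiple of `2π`. -/
lemma angles_one_ne_one (m : ℕ) : (angles 1 m : ℂ) ≠ 1 := by
  intro h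
  have h1 : Circle.exp (1 * (1 / 2) ^ m) = 1 := Circle.ext h
  obtain ⟨n, hn⟩ := Circle.exp_eq_one.1 h1
  have h2 : (0 : ℝ) < (1 / 2) ^ m := by positivity
  have h3 : (1 / 2 : ℝ) ^ m ≤ 1 := pow_le_one₀ (by norm_num) (by norm_num)
  have hπ := Real.pi_gt_three
  rw [one_mul] at hn
  have h4 : (0 : ℝ) < n := by
    by_contra! h
    nlinarith
  have h5 : (1 : ℝ) ≤ n := by exact_mod_cast h4
  nlinarith

/-- If `Γ` has a real character, then it has a unitary representation without invariant vectors
whose first cohomology does not vanish. -/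
lemma exists_not_subsingleton_cohomology_one (φ : Γ →* Multiplicative ℝ) {g₀ : Γ}
    (hg₀ : φ g₀ = Multiplicative.ofAdd 1) :
    ∃ ρ : UnitaryRep Γ (lp (fun _ : ℕ => ℂ) 2), NoInvariantVectors ρ ∧
      ¬ Subsingleton (Cohomology ρ 1) := by
  let χ : Γ →* (ℕ → Circle) := MonoidHom.mk' (fun g => angles (φ g).toAdd) fun g h => by
    funext m
    simp [angles, add_mul]
  have hχ (m : ℕ) : (χ g₀ m : ℂ) ≠ 1 := by
    have : χ g₀ m = angles 1 m := congrArg (fun x => angles (Multiplicative.toAdd x) m) hg₀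
    rw [this]
    exact angles_one_ne_one m
  refine ⟨diag.comp χ, fun v hv => lp.ext <| funext fun m => ?_, fun h => ?_⟩
  · have h1 : (χ g₀ m : ℂ) * v m = v m := congrFun (congrArg Subtype.val (hv g₀)) m
    have h2 : ((χ g₀ m : ℂ) - 1) * v m = 0 := by rw [sub_mul, h1, one_mul, sub_self]
    exact (mul_eq_zero.1 h2).resolve_left (sub_ne_zero.2 (hχ m))
  -- This is formally the coboundary of the constant sequence `1`. Its values are square-summable
  -- because the angles decay geometrically, but its only possible primitive, that constant
  -- sequence, is not in `ℓ²`.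
  · let b (g : Γ) : lp (fun _ : ℕ => ℂ) 2 := ⟨fun m => (χ g m : ℂ) - 1, by
      refine (memℓp_gen (p := 2) (f := fun m : ℕ => |(φ g).toAdd| * (1 / 2 : ℝ) ^ m) ?_).mono
        fun m => ?_
      · have h2 : Summable fun m : ℕ => |(φ g).toAdd| ^ 2 * (1 / 4 : ℝ) ^ m :=
          (summable_geometric_of_lt_one (by norm_num) (by norm_num)).mul_left _
        refine h2.congr fun m => ?_
        rw [ENNReal.toReal_ofNat, Real.rpow_ofNat, Real.norm_eq_abs, sq_abs (_ * _), mul_pow, ← pow_mul,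
          mul_comm m 2, pow_mul]
        norm_num
      · refine (norm_circle_exp_sub_one_le _).trans (le_of_eq ?_)
        rw [abs_mul, abs_of_pos (by positivity : (0 : ℝ) < (1 / 2) ^ m)]⟩
    have hb (g : Γ) (m : ℕ) : b g m = (χ g m : ℂ) - 1 := rfl
    obtain ⟨v, hv⟩ := (subsingleton_cohomology_one_iff _).1 h b fun g h =>
      lp.ext <| funext fun m => by
        rw [lp.coeFn_add, Pi.add_apply, MonoidHom.comp_apply, diag_apply, hb, hb, hb, map_mul,
          Pi.mul_apply, Circle.coe_mul]
        ring
    have hv1 (m : ℕ) : v m = 1 := by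
      have h1 : (χ g₀ m : ℂ) - 1 = χ g₀ m * v m - v m :=
        congrFun (congrArg Subtype.val (hv g₀)) m
      have h2 : ((χ g₀ m : ℂ) - 1) * (v m - 1) = 0 := by linear_combination -h1
      exact sub_eq_zero.1 ((mul_eq_zero.1 h2).resolve_left (sub_ne_zero.2 (hχ m)))
    have hsum := (lp.memℓp v).summable (by norm_num)
    simp only [hv1, norm_one, Real.one_rpow] at hsum
    exact one_ne_zero ((summable_const_iff _).1 hsum)

end Diagonal

/-! ### Real characters from an infinite abelianization. -/

section Abelianization

variable {Γ : Type u} [Group Γ]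

/-- An infinite finitely generated abelian group has positive free rank; the character is a
coordinate on the free part, and `g₀` lifts the corresponding basis vector. -/
lemma exists_real_character {S : Finset Γ} (hS : Subgroup.closure (S : Set Γ) = ⊤)
    (hfin : ¬ Finite (Abelianization Γ)) :
    ∃ (φ : Γ →* Multiplicative ℝ) (g₀ : Γ), φ g₀ = Multiplicative.ofAdd 1 := by
  have hfg : Group.FG Γ := ⟨S, hS⟩
  have hsurj : Function.Surjective (Abelianization.of : Γ →* Abelianization Γ) :=
    QuotientGroup.mk'_surjective _
  have hfg' : Group.FG (Abelianization Γ) := Group.fg_of_surjective hsurj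
  obtain ⟨n, ι, _, p, hp, e, ⟨f⟩⟩ :=
    AddCommGroup.equiv_free_prod_directSum_zmod (Additive (Abelianization Γ))
  rcases n with - | n
  · refine absurd ?_ hfin
    have (i : ι) : NeZero (p i ^ e i) := ⟨pow_ne_zero _ (hp i).ne_zero⟩
    have : Finite (DirectSum ι fun i => ZMod (p i ^ e i)) := by
      classical exact Finite.of_equiv _ DFinsupp.equivFunOnFintype.symm
    exact Finite.of_equiv _ (f.symm.toEquiv.trans Additive.toMul)
  · let ψ : Additive (Abelianization Γ) →+ ℝ :=
      ((Int.castAddHom ℝ).comp (Finsupp.applyAddHom 0)).comp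
        ((AddMonoidHom.fst _ _).comp f.toAddMonoidHom)
    obtain ⟨g₀, hg₀⟩ := hsurj
      (Additive.toMul (f.symm (Finsupp.single 0 1, 0)))
    refine ⟨(AddMonoidHom.toMultiplicativeRight ψ).comp Abelianization.of, g₀, ?_⟩
    rw [MonoidHom.comp_apply, hg₀]
    change Multiplicative.ofAdd (ψ (f.symm (Finsupp.single 0 1, 0))) = _
    simp [ψ]

/-- The first cohomology detects an infinite abelianization. -/
lemma PropertyParenT.finite_abelianization {n : ℕ} (hT : PropertyParenT Γ n) (hn : 1 ≤ n)
    (hΓ : IsFPRat Γ n) : Finite (Abelianization Γ) := by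
  by_contra hfin
  obtain ⟨S, hS⟩ := exists_finset_closure_eq_top hΓ hn
  obtain ⟨φ, g₀, hg₀⟩ := exists_real_character hS hfin
  obtain ⟨ρ, hinv, hρ⟩ := exists_not_subsingleton_cohomology_one φ hg₀
  exact hρ (hT _ ρ hinv 1 le_rfl hn)

end Abelianization

/-! ### Non-trivial irreducible representations. -/

section Irreducible

variable {Γ : Type u} [Group Γ] {V : Type} [NormedAddCommGroup V] [InnerProductSpace ℂ V]

lemma IsIrreducible.noInvariantVectors {ρ : UnitaryRep Γ V} (hρ : IsIrreducible ρ)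
    (htriv : ¬ IsTrivial ρ) : NoInvariantVectors ρ := by
  let W : Submodule ℂ V :=
    { carrier := {v | ∀ g, ρ g v = v}
      add_mem' := fun hv hw g => by rw [map_add, hv g, hw g]
      zero_mem' := fun g => map_zero _
      smul_mem' := fun c v hv g => by rw [map_smul, hv g] }
  have hW (v : V) : v ∈ W ↔ ∀ g, ρ g v = v := Iff.rfl
  have hcl : IsClosed (W : Set V) := by
    have : (W : Set V) = ⋂ g, {v | ρ g v = v} := by ext v; simp [hW]
    rw [this]
    exact isClosed_iInter fun g => isClosed_eq (ρ g).continuous continuous_id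
  rcases hρ.2 W hcl fun g w hw h => by rw [(hW w).1 hw g, (hW w).1 hw h] with h | h
  · exact fun v hv => (Submodule.eq_bot_iff W).1 h v hv
  · exact absurd (fun g v => (hW v).1 (h ▸ Submodule.mem_top) g) htriv

lemma HasGap.not_isTrivial [Nontrivial V] {ρ : UnitaryRep Γ V} {S : Finset Γ} {ε : ℝ}
    (h : HasGap ρ S ε) (hε : 0 < ε) : ¬ IsTrivial ρ := by
  intro ht
  obtain ⟨v, hv⟩ := exists_ne (0 : V)
  have h1 := h v
  have h2 (s : Γ) : ‖ρ s v - v‖ ^ 2 = 0 := by rw [ht s v]; simp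
  simp only [h2, Finset.sum_const_zero] at h1
  have : 0 < ‖v‖ := norm_pos_iff.2 hv
  exact absurd h1 (not_le.2 (by positivity))

/-- The void gap condition, for uses of the main construction where no gap has to be carried along.
-/
lemma hasGap_empty (ρ : UnitaryRep Γ V) : HasGap ρ ∅ 0 := fun v => by simp

end Irreducible

end HigherT

/-! ### The two equivalences. -/

theorem mainTheorem9 {Γ : Type u} [Group Γ] [Countable Γ] (n : ℕ) (hn : 1 ≤ n)
    (hΓ : HigherT.IsFPRat Γ n) :
    (HigherT.PropertyBracketT Γ n ↔
      ∀ (U : Type) [NormedAddCommGroup U] [InnerProductSpace ℂ U] [CompleteSpace U]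
        [TopologicalSpace.SeparableSpace U] (ρ : HigherT.UnitaryRep Γ U),
        HigherT.IsIrreducible ρ →
        ∀ k : ℕ, 0 < k → k ≤ n → Subsingleton (HigherT.ReducedCohomology ρ k)) ∧
    (HigherT.PropertyParenT Γ n ↔
      Finite (Abelianization Γ) ∧
      ∀ (U : Type) [NormedAddCommGroup U] [InnerProductSpace ℂ U] [CompleteSpace U]
        [TopologicalSpace.SeparableSpace U] (ρ : HigherT.UnitaryRep Γ U),
        HigherT.IsIrreducible ρ → ¬ HigherT.IsTrivial ρ →
        ∀ k : ℕ, 0 < k → k ≤ n → Subsingleton (HigherT.ReducedCohomology ρ k)) := by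
  refine ⟨⟨fun hT U _ _ _ _ ρ _ k hk hkn => ?_, fun hU V _ _ _ _ ρ k hk hkn => ?_⟩,
    ⟨fun hT => ⟨hT.finite_abelianization hn hΓ, fun U _ _ _ _ ρ hρ htriv k hk hkn => ?_⟩,
      fun ⟨hfin, hU⟩ V _ _ _ _ ρ hinv k hk hkn => ?_⟩⟩
  · have := hT U ρ k hk hkn
    exact (Submodule.mkQ_surjective _).subsingleton
  · by_contra hρ
    obtain ⟨k, rfl⟩ := Nat.exists_eq_add_of_le' hk
    obtain ⟨U, _, _, _, _, π, hπ, -, hne⟩ :=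
      HigherT.exists_irreducible_of_cohomology hΓ k hkn ρ (HigherT.hasGap_empty ρ) hρ
    exact hne (hU U π hπ _ k.succ_pos hkn)
  · have := hT U ρ (hρ.noInvariantVectors htriv) k hk hkn
    exact (Submodule.mkQ_surjective _).subsingleton
  -- Degree one comes first and without a gap: the irreducible representation obtained may be
  -- trivial, and that case is excluded by the finite abelianization.
  · have h1 : Subsingleton (HigherT.Cohomology ρ 1) := by
      by_contra hρ
      obtain ⟨U, _, _, _, _, π, hπ, -, hne⟩ :=
        HigherT.exists_irreducible_of_cohomology hΓ 0 hn ρ (HigherT.hasGap_empty ρ) hρ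
      by_cases htriv : HigherT.IsTrivial π
      · have := HigherT.subsingleton_cohomology_one_of_isTrivial htriv
        exact hne (Submodule.mkQ_surjective _).subsingleton
      · exact hne (hU U π hπ htriv 1 one_pos hn)
    -- The vanishing of `H^1` now yields a gap for `ρ`. It passes to the irreducible representation
    -- found in any degree up to `n`, which is therefore non-trivial.
    obtain ⟨S, hS⟩ := HigherT.exists_finset_closure_eq_top hΓ hn
    obtain ⟨ε, hε, hgap⟩ := HigherT.exists_hasGap hinv h1 hS
    by_contra hρ
    obtain ⟨k, rfl⟩ := Nat.exists_eq_add_of_le' hk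
    obtain ⟨U, _, _, _, _, π, hπ, hgapπ, hne⟩ :=
      HigherT.exists_irreducible_of_cohomology hΓ k hkn ρ hgap hρ
    have := hπ.1
    exact hne (hU U π hπ (hgapπ.not_isTrivial hε) _ k.succ_pos hkn)
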